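/- Let $m=(m_0,m_1,\dots)$ be a bounded sequence of integers $m_k\ge 2$, let $G_m=\prod_{k}\mathbb Z/m_k\mathbb Z$ be the corresponding bounded Vilenkin group with normalized Haar measure (the product of the uniform measures), and put $M_0=1$, $M_{k+1}=m_kM_k$. Write each $n\in\mathbb N$ as $n=\sum_k n_kM_k$ with $0\le n_k<m_k$, and let $\psi_n(x)=\prod_k r_k(x)^{n_k}$ with $r_k(x)=\exp(2\pi i x_k/m_k)$ be the Vilenkin system. Let $\mu$ be the product measure on $G_m^2=G_m\times G_m$; $L^p(G_m^2)$ is the usual complex Lebesgue space for $1\le p<\infty$, and $L^\infty(G_m^2)$ denotes the space $C(G_m^2)$ of continuous functions with the supremum norm. For $f\in L^p(G_m^2)$ let $\widehat f(k_1,k_2)=\int_{G_m^2} f(x,y)\overline{\psi_{k_1}(x)}\,\overline{\psi_{k_2}(y)}\,d\mu(x,y)$ and $S_{j,j}(f)(x,y)=\sum_{k_1=0}^{j-1}\sum_{k_2=0}^{j-1}\widehat f(k_1,k_2)\psi_{k_1}(x)\psi_{k_2}(y)$, and define the $(C,-\alpha)$ means of the quadratic partial sums by $$\sigma_n^{-\alpha}(f)=\frac1{A_{n-1}^{-\alpha}}\sum_{j=1}^{n}A_{n-j}^{-\alpha-1}S_{j,j}(f),\qquad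 A_0^{\beta}=1,\quad A_n^{\beta}=\frac{(\beta+1)\cdots(\beta+n)}{n!}.$$ Let $I_n=\{u\in G_m: u_0=\dots=u_{n-1}=0\}$ and let $$\omega_1(f,1/M_n)_p=\sup_{u\in I_n}\|f(\cdot+u,\cdot)-f\|_p,\qquad \omega_2(f,1/M_n)_p=\sup_{v\in I_n}\|f(\cdot,\cdot+v)-f\|_p$$ be the partial moduli of continuity. Let $\alpha\in(0,1)$. Then there is a constant $c(\alpha)$, depending only on $\alpha$ and on an upper bound for the sequence $m$, such that for every $p\in[1,\infty]$, every $f\in L^p(G_m^2)$, and all integers $k\ge 1$ and $n$ with $M_k\le n<M_{k+1}$, $$\|\sigma_n^{-\alpha}(f)-f\|_p\le c(\alpha)\Big(M_k^{\alpha}\log n\,\big(\omega_1(f,1/M_{k-1})_p+\omega_2(f,1/M_{k-1})_p\big)+\sum_{r=0}^{k-2}\frac{M_r}{M_k}\big(\omega_1(f,1/M_r)_p+\omega_2(f,1/M_r)_p\big)\Big),$$ where the sum is empty for $k=1$. -/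

import Mathlib

open MeasureTheory
open scoped ENNReal NNReal

noncomputable section

namespace Vilenkin

/-- The Vilenkin group `G_m`, the complete direct product of the groups `ℤ / m_k ℤ`; addition is
coordinatewise and the topology is the product of the discrete topologies. -/
abbrev G (m : ℕ → ℕ) : Type := (k : ℕ) → ZMod (m k)

/-- The Haar measure of `G_m`: the product of the uniform probability measures on `ℤ / m_k ℤ`. -/
def haar (m : ℕ → ℕ) : Measure (G m) :=
  Measure.infinitePi fun k => ProbabilityTheory.uniformOn (Set.univ : Set (ZMod (m k)))

/-- The Haar measure of the two-dimensional group `G_m × G_m`. -/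
def haar2 (m : ℕ → ℕ) : Measure (G m × G m) := (haar m).prod (haar m)

/-- The generalized powers `M_0 = 1`, `M_{k+1} = m_k M_k`. -/
def M (m : ℕ → ℕ) : ℕ → ℕ
  | 0 => 1
  | k + 1 => m k * M m k

/-- The `k`-th digit `n_k` of `n` in the generalized number system, `n = ∑ n_k M_k`. -/
def digit (m : ℕ → ℕ) (n k : ℕ) : ℕ := n / M m k % m k

lemma lt_M (m : ℕ → ℕ) (hm : ∀ k, 2 ≤ m k) (n : ℕ) : n < M m n := by
  induction n with
  | zero => simp [M]
  | succ n ih =>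
    have h : 2 * M m n ≤ m n * M m n := Nat.mul_le_mul_right _ (hm n)
    simp only [M]
    omega

/-- The digits of `n` with index at least `n` vanish. -/
lemma digit_eq_zero (m : ℕ → ℕ) (hm : ∀ k, 2 ≤ m k) {n k : ℕ} (h : n ≤ k) :
    digit m n k = 0 := by
  simp [digit, Nat.div_eq_of_lt (h.trans_lt (lt_M m hm k))]

/-- The digits of `n` are its expansion in the generalized number system. -/
lemma sum_digit (m : ℕ → ℕ) (n N : ℕ) :
    ∑ k ∈ Finset.range N, digit m n k * M m k = n % M m N := by
  induction N with
  | zero => simp [M, Nat.mod_one]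
  | succ N ih =>
    rw [Finset.sum_range_succ, ih, M, mul_comm (m N), Nat.mod_mul, digit, mul_comm (M m N)]

/-- The neighbourhood `I_n(x)`. -/
def I (m : ℕ → ℕ) (n : ℕ) (x : G m) : Set (G m) := {y | ∀ j < n, y j = x j}

/-- The generalized Rademacher functions `r_k(x) = exp(2πi x_k / m_k)`. -/
def rademacher (m : ℕ → ℕ) (k : ℕ) (x : G m) : ℂ :=
  Complex.exp (2 * Real.pi * Complex.I * ((x k).val : ℂ) / (m k : ℂ))

/-- The Vilenkin functions `ψ_n = ∏_k r_k ^ n_k`. The product over all `k` reduces to `k < n`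
because the other digits of `n` vanish (`digit_eq_zero`). -/
def psi (m : ℕ → ℕ) (n : ℕ) (x : G m) : ℂ :=
  ∏ k ∈ Finset.range n, rademacher m k x ^ digit m n k

/-- The two-dimensional Vilenkin-Fourier coefficients. -/
def fourierCoeff (m : ℕ → ℕ) (f : G m × G m → ℂ) (n₁ n₂ : ℕ) : ℂ :=
  ∫ z, f z * (starRingEnd ℂ) (psi m n₁ z.1) * (starRingEnd ℂ) (psi m n₂ z.2) ∂(haar2 m)

/-- The rectangular partial sums `S_{n₁,n₂}(x, y, f)`, `z = (x, y)`. -/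
def partialSum (m : ℕ → ℕ) (f : G m × G m → ℂ) (n₁ n₂ : ℕ) (z : G m × G m) : ℂ :=
  ∑ k₁ ∈ Finset.range n₁, ∑ k₂ ∈ Finset.range n₂,
    fourierCoeff m f k₁ k₂ * psi m k₁ z.1 * psi m k₂ z.2

/-- The Cesàro numbers `A_n^β = (β + 1) ⋯ (β + n) / n!`, with `A_0^β = 1`. -/
def cesaroA (β : ℝ) (n : ℕ) : ℝ :=
  (∏ i ∈ Finset.range n, (β + (i + 1))) / (n.factorial : ℝ)

/-- The `(C, -α)` means
`σ_n^{-α}(f) = (1 / A_{n-1}^{-α}) ∑_{j=1}^n A_{n-j}^{-α-1} S_{j,j}(f)` of the quadratic partial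
sums, for `n ≥ 1`. -/
def sigma (m : ℕ → ℕ) (α : ℝ) (n : ℕ) (f : G m × G m → ℂ) (z : G m × G m) : ℂ :=
  ((cesaroA (-α) (n - 1))⁻¹ : ℝ) *
    ∑ j ∈ Finset.Icc 1 n, (cesaroA (-α - 1) (n - j) : ℂ) * partialSum m f j j z

/-- Membership in `L^p(G_m²)`, where `L^∞` stands for the class of continuous functions. (For a
continuous function, `eLpNorm f ∞` is the supremum norm, since nonempty open sets have positive
measure.) -/
def InLp (m : ℕ → ℕ) (p : ℝ≥0∞) (f : G m × G m → ℂ) : Prop :=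
  MemLp f p (haar2 m) ∧ (p = ∞ → Continuous f)

/-- The partial modulus of continuity `ω₁(f, 1 / M_n)_p`. -/
def omega1 (m : ℕ → ℕ) (f : G m × G m → ℂ) (n : ℕ) (p : ℝ≥0∞) : ℝ≥0∞ :=
  ⨆ u ∈ I m n 0, eLpNorm (fun z => f (z.1 + u, z.2) - f z) p (haar2 m)

/-- The partial modulus of continuity `ω₂(f, 1 / M_n)_p`. -/
def omega2 (m : ℕ → ℕ) (f : G m × G m → ℂ) (n : ℕ) (p : ℝ≥0∞) : ℝ≥0∞ :=
  ⨆ v ∈ I m n 0, eLpNorm (fun z => f (z.1, z.2 + v) - f z) p (haar2 m)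

end Vilenkin

end

/-!
Write `σ_n f - f` as the average of `S_{j,j} f - f` with weights `A_{n-j}^{-α-1} / A_{n-1}^{-α}`,
and cut the range of `j` into the blocks `M_r ≤ j < M_{r+1}` with `r ≤ k - 2` and one last block
`j ≥ M_{k-1}`. The kernel of `S_{M_r,M_r}` is the normalized indicator of `I_r × I_r`, so
`g = f - S_{M_r,M_r} f` has norm at most `ω₁ + ω₂` at scale `1 / M_r`, while
`S_{j,j} f - f = S_{j,j} g - g` for `j ≥ M_r`. By Minkowski's integral inequality it remains to
bound the `L^1` norms of the kernels `∑_j c_j D_j ⊗ D_j`.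

In an early block the weights are `O(M_k^{-α-1})`, and `‖∑_{j < M_K} c_j D_j ⊗ D_j‖_1` is at most a
constant times `M_K sup |c_j|`: for `x` in the annulus `I_s ∖ I_{s+1}` the kernel expands into
blocks of length `M_{s+1}` whose contributions are multiples of the orthogonal functions
`ψ_{N M_{s+1}}`, and Bessel's inequality with Cauchy-Schwarz makes the sum over `s` converge
geometrically.

In the last block the kernel is that of the Cesàro means, up to an early part of the previous kind.
The Dirichlet kernels are affine on `I_s` in each block of `M_s` indices, and the partial sums
`∑_{i ≤ q} A_i^{-α-1} = A_q^{-α}` are small. This cancellation bounds the kernel on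
`(I_s ∖ I_{s+1}) × I_s` by `θ_s M_s F(y)` with `∑_s θ_s = O(1)` and a majorant `F` of all the
Dirichlet kernels whose integral is `O(k)`. Its `L^1` norm is therefore `O(k) = O(log n)`.
-/

namespace Vilenkin

section CesaroNumbers

lemma cesaroA_zero (β : ℝ) : cesaroA β 0 = 1 := by simp [cesaroA]

lemma cesaroA_succ (β : ℝ) (n : ℕ) :
    cesaroA β (n + 1) = cesaroA β n * ((β + (n + 1)) / (n + 1)) := by
  simp only [cesaroA, Finset.prod_range_succ, Nat.factorial_succ]
  push_cast
  field_simp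

lemma cesaroA_sub_one_succ (β : ℝ) (n : ℕ) :
    cesaroA (β - 1) (n + 1) = β / (n + 1) * cesaroA β n := by
  have shift (i : ℕ) : β - 1 + (((i + 1 : ℕ) : ℝ) + 1) = β + (i + 1) := by push_cast; ring
  simp only [cesaroA, Finset.prod_range_succ', Nat.factorial_succ, shift]
  push_cast
  field_simp
  ring

lemma sum_range_cesaroA_sub_one (β : ℝ) (n : ℕ) :
    ∑ i ∈ Finset.range (n + 1), cesaroA (β - 1) i = cesaroA β n := by
  induction n with
  | zero => simp [cesaroA_zero]
  | succ n ih =>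
    rw [Finset.sum_range_succ, ih, cesaroA_sub_one_succ, cesaroA_succ]
    field_simp
    ring

variable {α : ℝ}

lemma cesaroA_neg_pos (h1 : α < 1) (n : ℕ) : 0 < cesaroA (-α) n :=
  div_pos (Finset.prod_pos fun i _ => by linarith [i.cast_nonneg (α := ℝ)]) (by positivity)

lemma sum_range_cesaroA_neg (h1 : α < 1) (n : ℕ) :
    ∑ i ∈ Finset.range (n + 1), cesaroA (-α) i = cesaroA (-α) n * ((n + 1 - α) / (1 - α)) := by
  have : 1 - α ≠ 0 := by linarith
  induction n with
  | zero => simp [cesaroA_zero, this]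
  | succ n ih =>
    rw [Finset.sum_range_succ, ih, cesaroA_succ]
    push_cast
    field_simp
    ring

variable (h0 : 0 ≤ α) (h1 : α < 1)
include h0 h1

lemma cesaroA_neg_le (n : ℕ) : cesaroA (-α) n ≤ ((n : ℝ) + 1) ^ (-α) := by
  induction n with
  | zero => simp [cesaroA_zero]
  | succ n ih =>
    have ratio_nonneg : 0 ≤ (-α + (n + 1)) / ((n : ℝ) + 1) :=
      div_nonneg (by linarith [n.cast_nonneg (α := ℝ)]) (by positivity)
    have ratio_le : (-α + (n + 1)) / ((n : ℝ) + 1) ≤ (((n : ℝ) + 1) / (n + 2)) ^ α := by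
      have log_le : Real.log (((n : ℝ) + 2) / (n + 1)) ≤ 1 / (n + 1) :=
        (Real.log_le_sub_one_of_pos (by positivity)).trans_eq (by field_simp; ring)
      calc (-α + (n + 1)) / ((n : ℝ) + 1) = 1 - 1 / (n + 1) * α := by field_simp; ring
        _ ≤ 1 - Real.log (((n : ℝ) + 2) / (n + 1)) * α := by gcongr
        _ = Real.log (((n : ℝ) + 1) / (n + 2)) * α + 1 := by
          rw [← inv_div ((n : ℝ) + 2), Real.log_inv]; ring
        _ ≤ _ := by
          rw [Real.rpow_def_of_pos (by positivity)]
          exact Real.add_one_le_exp _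
    calc cesaroA (-α) (n + 1)
        = cesaroA (-α) n * ((-α + (n + 1)) / (n + 1)) := cesaroA_succ _ n
      _ ≤ ((n : ℝ) + 1) ^ (-α) * (((n : ℝ) + 1) / (n + 2)) ^ α := by gcongr
      _ = (((n + 1 : ℕ) : ℝ) + 1) ^ (-α) := by
        rw [Real.div_rpow (by positivity) (by positivity), Real.rpow_neg (by positivity),
          Real.rpow_neg (by positivity)]
        push_cast
        field_simp
        ring_nf

lemma mul_rpow_neg_le_cesaroA_neg_succ (n : ℕ) :
    (1 - α) * ((n : ℝ) + 1) ^ (-α) ≤ cesaroA (-α) (n + 1) := by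
  induction n with
  | zero => simp [cesaroA_succ, cesaroA_zero, sub_eq_neg_add]
  | succ n ih =>
    have bernoulli : (((n : ℝ) + 1) / (n + 2)) ^ α ≤ (-α + (n + 2)) / (n + 2) := by
      have h := rpow_one_add_le_one_add_mul_self (s := -1 / ((n : ℝ) + 2)) (p := α)
        (by rw [le_div_iff₀ (by positivity)]; linarith [n.cast_nonneg (α := ℝ)]) h0 h1.le
      convert h using 1
      · congr 1; field_simp; ring
      · field_simp
        ring
    calc (1 - α) * (((n + 1 : ℕ) : ℝ) + 1) ^ (-α)
        = (1 - α) * ((n : ℝ) + 1) ^ (-α) * (((n : ℝ) + 1) / (n + 2)) ^ α := by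
          rw [Real.div_rpow (by positivity) (by positivity), Real.rpow_neg (by positivity),
            Real.rpow_neg (by positivity)]
          push_cast
          field_simp
          ring_nf
      _ ≤ cesaroA (-α) (n + 1) * ((-α + (n + 2)) / (n + 2)) := by
          have := (cesaroA_neg_pos h1 (n + 1)).le
          gcongr
      _ = cesaroA (-α) (n + 1 + 1) := by
          rw [cesaroA_succ _ (n + 1)]
          push_cast
          ring_nf

lemma mul_rpow_neg_le_cesaroA_neg (n : ℕ) :
    (1 - α) * ((n : ℝ) + 1) ^ (-α) ≤ cesaroA (-α) n := by
  cases n with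
  | zero => simpa [cesaroA_zero]
  | succ n =>
    refine le_trans ?_ (mul_rpow_neg_le_cesaroA_neg_succ h0 h1 n)
    refine mul_le_mul_of_nonneg_left ?_ (sub_nonneg.2 h1.le)
    exact Real.rpow_le_rpow_of_nonpos (by positivity) (by push_cast; linarith) (by linarith)

lemma inv_cesaroA_neg_le (n : ℕ) : (cesaroA (-α) n)⁻¹ ≤ ((n : ℝ) + 1) ^ α / (1 - α) := by
  have h : 0 < (1 - α) * ((n : ℝ) + 1) ^ (-α) := mul_pos (by linarith) (by positivity)
  refine (inv_anti₀ h (mul_rpow_neg_le_cesaroA_neg h0 h1 n)).trans_eq ?_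
  rw [Real.rpow_neg (by positivity), mul_inv, inv_inv, mul_comm, div_eq_mul_inv]

lemma abs_cesaroA_neg_sub_one_succ (n : ℕ) :
    |cesaroA (-α - 1) (n + 1)| = α / (n + 1) * cesaroA (-α) n := by
  rw [cesaroA_sub_one_succ, abs_mul, abs_of_pos (cesaroA_neg_pos h1 n), abs_div, abs_neg,
    abs_of_nonneg h0, abs_of_pos (by positivity)]

lemma abs_cesaroA_neg_sub_one_le {n : ℕ} (hn : 1 ≤ n) :
    |cesaroA (-α - 1) n| ≤ (n : ℝ) ^ (-α - 1) := by
  obtain ⟨n, rfl⟩ := Nat.exists_eq_add_of_le' hn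
  have := cesaroA_neg_pos h1 n
  calc |cesaroA (-α - 1) (n + 1)| = α / (n + 1) * cesaroA (-α) n :=
        abs_cesaroA_neg_sub_one_succ h0 h1 n
    _ ≤ 1 / ((n : ℝ) + 1) * ((n : ℝ) + 1) ^ (-α) := by
        gcongr
        exact cesaroA_neg_le h0 h1 n
    _ = ((n + 1 : ℕ) : ℝ) ^ (-α - 1) := by
        rw [Real.rpow_sub_one (by positivity)]
        push_cast
        ring

lemma abs_cesaroA_neg_sub_one_eq_sub (n : ℕ) :
    |cesaroA (-α - 1) (n + 1)| = cesaroA (-α) n - cesaroA (-α) (n + 1) := by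
  rw [abs_cesaroA_neg_sub_one_succ h0 h1, cesaroA_succ]
  field_simp
  ring

lemma sum_Ico_abs_cesaroA_le (q R : ℕ) :
    ∑ i ∈ Finset.Ico (q + 1) R, |cesaroA (-α - 1) i| ≤ ((q : ℝ) + 1) ^ (-α) := by
  have term_eq (i : ℕ) : |cesaroA (-α - 1) (q + 1 + i)|
      = cesaroA (-α) (q + i) - cesaroA (-α) (q + (i + 1)) := by
    rw [add_right_comm, abs_cesaroA_neg_sub_one_eq_sub h0 h1, add_assoc]
  have telescope : ∑ i ∈ Finset.Ico (q + 1) R, |cesaroA (-α - 1) i|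
      = cesaroA (-α) q - cesaroA (-α) (q + (R - (q + 1))) := by
    simp only [Finset.sum_Ico_eq_sum_range, term_eq]
    exact Finset.sum_range_sub' (fun i => cesaroA (-α) (q + i)) _
  linarith [cesaroA_neg_pos h1 (q + (R - (q + 1))), cesaroA_neg_le h0 h1 q]

lemma sum_range_abs_cesaroA_le (R : ℕ) :
    ∑ i ∈ Finset.range R, |cesaroA (-α - 1) i| ≤ 2 := by
  cases R with
  | zero => simp
  | succ R =>
    have := sum_Ico_abs_cesaroA_le h0 h1 0 (R + 1)
    rw [Finset.range_eq_Ico, Finset.sum_eq_sum_Ico_succ_bot (by omega), cesaroA_zero]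
    simp only [Nat.cast_zero, zero_add, Real.one_rpow, abs_one] at this ⊢
    linarith

lemma sum_range_abs_cesaroA_sub_le (n : ℕ) :
    ∑ j ∈ Finset.range (n + 1), |cesaroA (-α - 1) (n - j)| ≤ 2 :=
  (Finset.sum_flip fun i => |cesaroA (-α - 1) i|).trans_le
    (sum_range_abs_cesaroA_le h0 h1 (n + 1))

lemma sum_range_abs_cesaroA_mul_le (R : ℕ) :
    ∑ i ∈ Finset.range (R + 1), |cesaroA (-α - 1) i| * i ≤ (R : ℝ) ^ (1 - α) / (1 - α) := by
  have : 0 < 1 - α := sub_pos.2 h1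
  have term_eq (i : ℕ) :
      |cesaroA (-α - 1) (i + 1)| * ((i + 1 : ℕ) : ℝ) = α * cesaroA (-α) i := by
    rw [abs_cesaroA_neg_sub_one_succ h0 h1]
    push_cast
    field_simp
  simp only [Finset.sum_range_succ', term_eq, Nat.cast_zero, mul_zero, add_zero, ← Finset.mul_sum]
  cases R with
  | zero =>
    simp only [Finset.range_zero, Finset.sum_empty, mul_zero]
    positivity
  | succ n =>
    have hA := cesaroA_neg_pos h1 n
    have hn : (0 : ℝ) ≤ n + 1 - α := by linarith [n.cast_nonneg (α := ℝ)]
    calc α * ∑ i ∈ Finset.range (n + 1), cesaroA (-α) i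
        = α * (cesaroA (-α) n * (n + 1 - α)) / (1 - α) := by
          rw [sum_range_cesaroA_neg h1]; ring
      _ ≤ 1 * (((n : ℝ) + 1) ^ (-α) * (n + 1)) / (1 - α) := by
          gcongr
          · exact cesaroA_neg_le h0 h1 n
          · linarith
      _ = ((n + 1 : ℕ) : ℝ) ^ (1 - α) / (1 - α) := by
          rw [one_mul, ← Real.rpow_add_one (by positivity)]
          push_cast
          ring_nf

end CesaroNumbers

section HaarMeasure

lemma map_uniformOn_univ {X : Type*} [Finite X] [MeasurableSpace X] [MeasurableSingletonClass X]
    (e : X ≃ X) :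
    (ProbabilityTheory.uniformOn (Set.univ : Set X)).map e
      = ProbabilityTheory.uniformOn Set.univ := by
  have := Fintype.ofFinite X
  ext s hs
  rw [Measure.map_apply (measurable_of_finite _) hs, ProbabilityTheory.uniformOn_univ,
    ProbabilityTheory.uniformOn_univ, Measure.count_apply (measurable_of_finite _ hs),
    Measure.count_apply hs, Set.encard_preimage_of_bijective e.bijective]

variable {m : ℕ → ℕ}

lemma M_eq_prod (k : ℕ) : M m k = ∏ i ∈ Finset.range k, m i := by
  induction k with
  | zero => rfl
  | succ k ih => rw [M, ih, Finset.prod_range_succ, mul_comm]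

lemma measurableSet_I (s : ℕ) (x : G m) : MeasurableSet (I m s x) := by
  have : I m s x = ⋂ j ∈ Finset.range s, (fun y : G m => y j) ⁻¹' {x j} := by
    ext y; simp [I]
  rw [this]
  exact Finset.measurableSet_biInter _ fun j _ => measurable_pi_apply j (MeasurableSet.singleton _)

variable [∀ k, NeZero (m k)]

instance : IsProbabilityMeasure (haar m) := by unfold haar; infer_instance

instance : IsProbabilityMeasure (haar2 m) := by unfold haar2; infer_instance

instance : Measure.IsAddLeftInvariant (haar m) where
  map_add_left_eq_self g := by
    have h := Measure.infinitePi_map_pi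
      (μ := fun k => ProbabilityTheory.uniformOn (Set.univ : Set (ZMod (m k))))
      (f := fun k => Equiv.addLeft (g k)) (fun k => measurable_of_finite _)
    simp only [map_uniformOn_univ] at h
    exact h

instance : MeasurableAdd₂ (G m) where
  measurable_add := measurable_pi_lambda _ fun k =>
    show Measurable ((fun p : ZMod (m k) × ZMod (m k) => p.1 + p.2) ∘
      fun q : G m × G m => (q.1 k, q.2 k)) from
    (measurable_of_finite _).comp (((measurable_pi_apply k).comp measurable_fst).prodMk
      ((measurable_pi_apply k).comp measurable_snd))

instance : Measure.IsAddLeftInvariant (haar2 m) :=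
  Measure.prod.instIsAddLeftInvariant (μ := haar m) (ν := haar m)

lemma haar_I (s : ℕ) (x : G m) : haar m (I m s x) = ((M m s : ℕ) : ℝ≥0∞)⁻¹ := by
  have cylinder : I m s x = Set.pi (Finset.range s) fun j => {x j} := by
    ext y; simp [I, Set.mem_pi]
  have uniformOn_singleton (i : ℕ) : ProbabilityTheory.uniformOn (Set.univ : Set (ZMod (m i))) {x i}
      = ((m i : ℕ) : ℝ≥0∞)⁻¹ := by
    simp [ProbabilityTheory.uniformOn_univ, ZMod.card]
  rw [cylinder, haar, Measure.infinitePi_pi _ fun _ _ => MeasurableSet.singleton _, M_eq_prod,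
    Nat.cast_prod, ENNReal.prod_inv_distrib fun i _ j _ _ => Or.inr (ENNReal.natCast_ne_top _)]
  simp only [uniformOn_singleton]

lemma haar_real_I (s : ℕ) (x : G m) : (haar m).real (I m s x) = ((M m s : ℕ) : ℝ)⁻¹ := by
  simp [Measure.real, haar_I]

end HaarMeasure

section Digits

variable {m : ℕ → ℕ}

lemma M_dvd_M {s k : ℕ} (h : s ≤ k) : M m s ∣ M m k := by
  induction k, h using Nat.le_induction with
  | base => exact dvd_rfl
  | succ k _ ih => exact ih.trans (Dvd.intro_left (m k) rfl)

lemma digit_eq_mod_div (n k : ℕ) : digit m n k = n % M m (k + 1) / M m k := by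
  rw [digit, M, mul_comm, Nat.mod_mul_right_div_self]

lemma mod_M_succ (n k : ℕ) : n % M m (k + 1) = n % M m k + M m k * digit m n k := by
  rw [M, mul_comm (m k), Nat.mod_mul, digit]

lemma digit_mul_M_of_lt (N : ℕ) {s k : ℕ} (h : k < s) : digit m (N * M m s) k = 0 := by
  obtain ⟨c, hc⟩ := M_dvd_M (m := m) (Nat.succ_le_of_lt h)
  rw [digit_eq_mod_div, hc, mul_left_comm, Nat.mul_mod_right, Nat.zero_div]

variable [∀ k, NeZero (m k)]

lemma M_pos (k : ℕ) : 0 < M m k := by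
  rw [M_eq_prod]
  exact Finset.prod_pos fun i _ => NeZero.pos (m i)

lemma M_le_M {s k : ℕ} (h : s ≤ k) : M m s ≤ M m k := Nat.le_of_dvd (M_pos k) (M_dvd_M h)

lemma digit_eq_zero_of_lt {n s k : ℕ} (h : n < M m s) (hk : s ≤ k) : digit m n k = 0 := by
  simp [digit, Nat.div_eq_of_lt (h.trans_le (M_le_M hk))]

lemma digit_mul_M_add (N s k : ℕ) {l : ℕ} (hl : l < M m s) :
    digit m (N * M m s + l) k = digit m (N * M m s) k + digit m l k := by
  rcases lt_or_ge k s with h | h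
  · obtain ⟨c, hc⟩ := M_dvd_M (m := m) (Nat.succ_le_of_lt h)
    rw [digit_mul_M_of_lt N h, zero_add, digit_eq_mod_div, digit_eq_mod_div, hc, mul_left_comm,
      Nat.mul_add_mod]
  · obtain ⟨c, hc⟩ := M_dvd_M (m := m) h
    have div_eq : (N * M m s + l) / M m k = N * M m s / M m k := by
      rw [hc, ← Nat.div_div_eq_div_mul, ← Nat.div_div_eq_div_mul, add_comm,
        Nat.add_mul_div_right _ _ (M_pos s), Nat.div_eq_of_lt hl, zero_add,
        Nat.mul_div_cancel _ (M_pos s)]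
    rw [digit_eq_zero_of_lt hl h, add_zero, digit, digit, div_eq]

lemma eq_of_digit_eq (hm : ∀ k, 2 ≤ m k) {a b : ℕ} (h : ∀ k, digit m a k = digit m b k) :
    a = b := by
  have ha : a < M m (a + b) := (lt_M m hm a).trans_le (M_le_M (Nat.le_add_right a b))
  have hb : b < M m (a + b) := (lt_M m hm b).trans_le (M_le_M (Nat.le_add_left b a))
  calc a = ∑ k ∈ Finset.range (a + b), digit m a k * M m k := by
        rw [sum_digit, Nat.mod_eq_of_lt ha]
    _ = b := by simp only [h, sum_digit, Nat.mod_eq_of_lt hb]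

end Digits

section Intervals

variable {m : ℕ → ℕ}

lemma I_antitone {s t : ℕ} (h : s ≤ t) (x : G m) : I m t x ⊆ I m s x :=
  fun _ hx j hj => hx j (hj.trans_le h)

lemma mem_I_succ {s : ℕ} {x y : G m} : y ∈ I m (s + 1) x ↔ y ∈ I m s x ∧ y s = x s :=
  Nat.forall_lt_succ_right

lemma add_mem_I_iff {s : ℕ} {e : G m} (he : e ∈ I m s 0) {x : G m} :
    e + x ∈ I m s 0 ↔ x ∈ I m s 0 :=
  forall₂_congr fun j hj => by simp [he j hj]

lemma exists_mem_I_ne_zero {K : ℕ} {x : G m} (h : x ∉ I m K 0) :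
    ∃ s < K, x ∈ I m s 0 ∧ x s ≠ 0 := by
  induction K with
  | zero => exact absurd (fun j hj => absurd hj (Nat.not_lt_zero j)) h
  | succ K ih =>
    by_cases hx : x ∈ I m K 0
    · exact ⟨K, K.lt_succ_self, hx, fun h0 => h (mem_I_succ.2 ⟨hx, h0⟩)⟩
    · obtain ⟨s, hs, h'⟩ := ih hx
      exact ⟨s, hs.trans K.lt_succ_self, h'⟩

end Intervals

section Characters

variable {m : ℕ → ℕ}

lemma psi_eq_prod (hm : ∀ k, 2 ≤ m k) {n K : ℕ} (h : n ≤ K) (x : G m) :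
    psi m n x = ∏ k ∈ Finset.range K, rademacher m k x ^ digit m n k := by
  refine Finset.prod_subset (Finset.range_mono h) fun k _ hk => ?_
  rw [digit_eq_zero m hm (not_lt.1 (mt Finset.mem_range.2 hk)), pow_zero]

variable [∀ k, NeZero (m k)]

lemma rademacher_eq (k : ℕ) (x : G m) : rademacher m k x = ZMod.stdAddChar (x k) := by
  rw [ZMod.stdAddChar_apply, ZMod.toCircle_apply, rademacher]

lemma rademacher_add (k : ℕ) (x y : G m) :
    rademacher m k (x + y) = rademacher m k x * rademacher m k y := by
  simp only [rademacher_eq, Pi.add_apply, AddChar.map_add_eq_mul]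

lemma norm_rademacher (k : ℕ) (x : G m) : ‖rademacher m k x‖ = 1 := by
  rw [rademacher_eq, ZMod.stdAddChar_apply]
  exact Circle.norm_coe _

lemma rademacher_eq_one {k : ℕ} {x : G m} : rademacher m k x = 1 ↔ x k = 0 := by
  rw [rademacher_eq, ← AddChar.map_zero_eq_one (ZMod.stdAddChar (N := m k)),
    ZMod.injective_stdAddChar.eq_iff]

lemma rademacher_pow (k : ℕ) (x : G m) : rademacher m k x ^ m k = 1 := by
  rw [rademacher_eq, ← AddChar.map_nsmul_eq_pow]
  simp

lemma measurable_rademacher (k : ℕ) : Measurable (rademacher m k) := by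
  simp only [funext (rademacher_eq (m := m) k)]
  exact (measurable_of_finite (ZMod.stdAddChar (N := m k))).comp (measurable_pi_apply k)

lemma psi_add (n : ℕ) (x y : G m) : psi m n (x + y) = psi m n x * psi m n y := by
  simp only [psi, rademacher_add, mul_pow, Finset.prod_mul_distrib]

lemma norm_psi (n : ℕ) (x : G m) : ‖psi m n x‖ = 1 := by
  simp [psi, norm_rademacher]

lemma psi_mul_conj_psi (n : ℕ) (x : G m) : psi m n x * (starRingEnd ℂ) (psi m n x) = 1 := by
  rw [Complex.mul_conj, Complex.normSq_eq_norm_sq, norm_psi]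
  simp

@[fun_prop]
lemma measurable_psi (n : ℕ) : Measurable (psi m n) := by
  unfold psi
  exact Finset.measurable_prod _ fun k _ => (measurable_rademacher k).pow_const _

lemma psi_of_mem_I {n s : ℕ} (h : n < M m s) {x : G m} (hx : x ∈ I m s 0) : psi m n x = 1 := by
  refine Finset.prod_eq_one fun k _ => ?_
  rcases lt_or_ge k s with hk | hk
  · rw [rademacher_eq_one.2 (hx k hk), one_pow]
  · rw [digit_eq_zero_of_lt h hk, pow_zero]

variable (hm : ∀ k, 2 ≤ m k)
include hm

lemma psi_mul_M_add (N s : ℕ) {l : ℕ} (hl : l < M m s) (x : G m) :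
    psi m (N * M m s + l) x = psi m (N * M m s) x * psi m l x := by
  rw [psi_eq_prod hm le_rfl, psi_eq_prod hm (Nat.le_add_right (N * M m s) l),
    psi_eq_prod hm (Nat.le_add_left l (N * M m s)), ← Finset.prod_mul_distrib]
  simp only [digit_mul_M_add N s _ hl, pow_add]

lemma psi_mul_M_of_lt {s b : ℕ} (hb : b < m s) (x : G m) :
    psi m (b * M m s) x = rademacher m s x ^ b := by
  have hlt : b * M m s < M m (s + 1) := Nat.mul_lt_mul_of_pos_right hb (M_pos s)
  rw [psi_eq_prod hm (Nat.le_add_right (b * M m s) (s + 1)),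
    Finset.prod_eq_single_of_mem s (Finset.mem_range.2 (by omega))]
  · rw [digit, Nat.mul_div_cancel _ (M_pos s), Nat.mod_eq_of_lt hb]
  · intro k _ hk
    rcases lt_or_gt_of_ne hk with h | h
    · rw [digit_mul_M_of_lt _ h, pow_zero]
    · rw [digit_eq_zero_of_lt hlt h, pow_zero]

lemma psi_single (n k : ℕ) :
    psi m n (Pi.single k 1) = ZMod.stdAddChar ((digit m n k : ℕ) : ZMod (m k)) := by
  rw [psi_eq_prod hm (Nat.le_add_right n (k + 1)),
    Finset.prod_eq_single_of_mem k (Finset.mem_range.2 (by omega))]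
  · rw [rademacher_eq, ← AddChar.map_nsmul_eq_pow, Pi.single_eq_same, nsmul_one]
  · intro j _ hj
    rw [rademacher_eq_one.2 (Pi.single_eq_of_ne hj _), one_pow]

lemma exists_mem_I_psi_ne {a b s : ℕ} (hab : a ≠ b) (ha : M m s ∣ a) (hb : M m s ∣ b) :
    ∃ e ∈ I m s 0, psi m a e ≠ psi m b e := by
  obtain ⟨k, hk⟩ : ∃ k, digit m a k ≠ digit m b k := by
    by_contra! h
    exact hab (eq_of_digit_eq hm h)
  have hsk : s ≤ k := by
    by_contra! h
    obtain ⟨c, rfl⟩ := ha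
    obtain ⟨d, rfl⟩ := hb
    rw [mul_comm, mul_comm _ d, digit_mul_M_of_lt _ h, digit_mul_M_of_lt _ h] at hk
    exact hk rfl
  have digit_lt (n : ℕ) : digit m n k < m k := Nat.mod_lt _ (NeZero.pos _)
  refine ⟨Pi.single k 1, fun j hj => Pi.single_eq_of_ne (hj.trans_le hsk).ne _, fun h => hk ?_⟩
  rwa [psi_single hm, psi_single hm, ZMod.injective_stdAddChar.eq_iff,
    ZMod.natCast_eq_natCast_iff', Nat.mod_eq_of_lt (digit_lt a), Nat.mod_eq_of_lt (digit_lt b)] at h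

lemma integral_mul_psi_mul_conj_psi {a b s : ℕ} (hab : a ≠ b) (ha : M m s ∣ a) (hb : M m s ∣ b)
    {g : G m → ℂ} (hg : ∀ e ∈ I m s 0, ∀ x, g (e + x) = g x) :
    ∫ x, g x * (psi m a x * (starRingEnd ℂ) (psi m b x)) ∂haar m = 0 := by
  obtain ⟨e, he, hne⟩ := exists_mem_I_psi_ne hm hab ha hb
  set J := ∫ x, g x * (psi m a x * (starRingEnd ℂ) (psi m b x)) ∂haar m
  have translate (x : G m) : g (e + x) * (psi m a (e + x) * (starRingEnd ℂ) (psi m b (e + x)))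
      = psi m a e * (starRingEnd ℂ) (psi m b e)
        * (g x * (psi m a x * (starRingEnd ℂ) (psi m b x))) := by
    rw [hg e he, psi_add, psi_add, map_mul]
    ring
  have fixed : psi m a e * (starRingEnd ℂ) (psi m b e) * J = 1 * J := by
    rw [one_mul, ← integral_const_mul]
    simp only [← translate]
    exact integral_add_left_eq_self
      (fun x => g x * (psi m a x * (starRingEnd ℂ) (psi m b x))) e
  by_contra hJ
  apply hne
  calc psi m a e = psi m a e * (psi m b e * (starRingEnd ℂ) (psi m b e)) := by
        rw [psi_mul_conj_psi, mul_one]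
    _ = psi m a e * (starRingEnd ℂ) (psi m b e) * psi m b e := by ring
    _ = psi m b e := by rw [mul_right_cancel₀ hJ fixed, one_mul]

end Characters

section DirichletKernel

variable {m : ℕ → ℕ}

/-- The Dirichlet kernel `D_j = ∑_{a < j} ψ_a` of the one-dimensional partial sums. -/
noncomputable def dirichlet (m : ℕ → ℕ) (j : ℕ) (x : G m) : ℂ := ∑ a ∈ Finset.range j, psi m a x

/-- The indicator function of the subgroup `I_s`, normalized to have integral `1`. -/
noncomputable def delta (m : ℕ → ℕ) (s : ℕ) : G m → ℝ :=
  (I m s 0).indicator fun _ => (M m s : ℝ)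

lemma dirichlet_zero (x : G m) : dirichlet m 0 x = 0 := rfl

lemma delta_of_mem {s : ℕ} {x : G m} (h : x ∈ I m s 0) : delta m s x = M m s :=
  Set.indicator_of_mem h _

lemma delta_of_notMem {s : ℕ} {x : G m} (h : x ∉ I m s 0) : delta m s x = 0 :=
  Set.indicator_of_notMem h _

lemma delta_nonneg (s : ℕ) (x : G m) : 0 ≤ delta m s x :=
  Set.indicator_nonneg (fun _ _ => Nat.cast_nonneg _) x

@[fun_prop]
lemma measurable_delta (s : ℕ) : Measurable (delta m s) :=
  measurable_const.indicator (measurableSet_I s 0)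

variable [∀ k, NeZero (m k)]

lemma integrable_delta (s : ℕ) : Integrable (delta m s) (haar m) :=
  (integrable_const _).indicator (measurableSet_I s 0)

lemma integral_delta (s : ℕ) : ∫ x, delta m s x ∂haar m = 1 := by
  have : (M m s : ℝ) ≠ 0 := by exact_mod_cast (M_pos s).ne'
  rw [delta, integral_indicator (measurableSet_I s 0), setIntegral_const, haar_real_I, smul_eq_mul,
    inv_mul_cancel₀ this]

lemma norm_dirichlet_le (j : ℕ) (x : G m) : ‖dirichlet m j x‖ ≤ j := by
  refine (norm_sum_le _ _).trans ?_
  simp [norm_psi]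

@[fun_prop]
lemma measurable_dirichlet (j : ℕ) : Measurable (dirichlet m j) := by
  unfold dirichlet
  exact Finset.measurable_sum _ fun k _ => measurable_psi k

lemma dirichlet_of_mem_I {j s : ℕ} (h : j ≤ M m s) {x : G m} (hx : x ∈ I m s 0) :
    dirichlet m j x = j := by
  rw [dirichlet, Finset.sum_congr rfl fun a ha =>
    psi_of_mem_I ((Finset.mem_range.1 ha).trans_le h) hx]
  simp

lemma dirichlet_add_of_mem_I {j t : ℕ} (hj : j ≤ M m t) {e : G m} (he : e ∈ I m t 0) (x : G m) :
    dirichlet m j (e + x) = dirichlet m j x := by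
  refine Finset.sum_congr rfl fun a ha => ?_
  rw [psi_add, psi_of_mem_I ((Finset.mem_range.1 ha).trans_le hj) he, one_mul]

variable (hm : ∀ k, 2 ≤ m k)
include hm

lemma dirichlet_mul_M_add (N s : ℕ) {l : ℕ} (hl : l ≤ M m s) (x : G m) :
    dirichlet m (N * M m s + l) x
      = dirichlet m (N * M m s) x + psi m (N * M m s) x * dirichlet m l x := by
  simp only [dirichlet, Finset.sum_range_add, Finset.mul_sum]
  congr 1
  exact Finset.sum_congr rfl fun a ha =>
    psi_mul_M_add hm N s ((Finset.mem_range.1 ha).trans_le hl) x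

lemma dirichlet_mul_M (N s : ℕ) (x : G m) :
    dirichlet m (N * M m s) x
      = dirichlet m (M m s) x * ∑ b ∈ Finset.range N, psi m (b * M m s) x := by
  induction N with
  | zero => simp [dirichlet_zero]
  | succ N ih =>
    rw [Nat.succ_mul, dirichlet_mul_M_add hm N s le_rfl, ih, Finset.sum_range_succ]
    ring

lemma dirichlet_mul_M_eq_zero (N : ℕ) {s : ℕ} {x : G m} (hxs : x s ≠ 0) :
    dirichlet m (N * M m (s + 1)) x = 0 := by
  have geometric : ∑ b ∈ Finset.range (m s), psi m (b * M m s) x = 0 := by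
    rw [Finset.sum_congr rfl fun b hb => psi_mul_M_of_lt hm (Finset.mem_range.1 hb) x,
      geom_sum_eq (mt rademacher_eq_one.1 hxs), rademacher_pow, sub_self, zero_div]
  rw [dirichlet_mul_M hm, M, dirichlet_mul_M hm, geometric, mul_zero, zero_mul]

lemma dirichlet_M (K : ℕ) (x : G m) : dirichlet m (M m K) x = delta m K x := by
  by_cases hx : x ∈ I m K 0
  · rw [delta_of_mem hx, dirichlet_of_mem_I le_rfl hx, Complex.ofReal_natCast]
  · obtain ⟨s, hs, -, hxs⟩ := exists_mem_I_ne_zero hx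
    obtain ⟨c, hc⟩ := M_dvd_M (m := m) (Nat.succ_le_of_lt hs)
    rw [delta_of_notMem hx, hc, mul_comm, dirichlet_mul_M_eq_zero hm _ hxs, Complex.ofReal_zero]

lemma norm_dirichlet_mul_M_le (N K : ℕ) (x : G m) :
    ‖dirichlet m (N * M m K) x‖ ≤ N * delta m K x := by
  rw [dirichlet_mul_M hm, dirichlet_M hm, norm_mul, mul_comm, Complex.norm_real,
    Real.norm_of_nonneg (delta_nonneg K x)]
  refine mul_le_mul_of_nonneg_right ((norm_sum_le _ _).trans ?_) (delta_nonneg K x)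
  simp [norm_psi]

lemma dirichlet_mul_M_add_of_mem_I (N : ℕ) {s l : ℕ} (hl : l ≤ M m s) {x : G m}
    (hx : x ∈ I m s 0) :
    dirichlet m (N * M m s + l) x = dirichlet m (N * M m s) x + psi m (N * M m s) x * l := by
  rw [dirichlet_mul_M_add hm N s hl, dirichlet_of_mem_I hl hx]

lemma norm_dirichlet_sub_le (N : ℕ) {s l l' : ℕ} (hl : l ≤ M m s) (hl' : l' ≤ l) {x : G m}
    (hx : x ∈ I m s 0) :
    ‖dirichlet m (N * M m s + l') x - dirichlet m (N * M m s + l) x‖ ≤ (l : ℝ) - l' := by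
  rw [dirichlet_mul_M_add_of_mem_I hm N hl hx,
    dirichlet_mul_M_add_of_mem_I hm N (hl'.trans hl) hx, add_sub_add_left_eq_sub, ← mul_sub,
    norm_mul, norm_psi, one_mul, norm_sub_rev, ← Nat.cast_sub hl', Complex.norm_natCast,
    Nat.cast_sub hl']

end DirichletKernel

section DirichletMajorant

variable {m : ℕ → ℕ}

/-- A majorant on `I_s` of all the Dirichlet kernels `D_j` with `j ≤ M_K`, when `B` is an upper
bound of the sequence `m`. Its integral is only of order `K - s`. -/
noncomputable def dirichletMajorant (m : ℕ → ℕ) (B s K : ℕ) (x : G m) : ℝ :=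
  delta m s x + B * ∑ r ∈ Finset.Ico s K, delta m r x

lemma delta_le_dirichletMajorant (B s K : ℕ) (x : G m) :
    delta m s x ≤ dirichletMajorant m B s K x :=
  le_add_of_nonneg_right
    (mul_nonneg B.cast_nonneg (Finset.sum_nonneg fun r _ => delta_nonneg r x))

lemma dirichletMajorant_nonneg (B s K : ℕ) (x : G m) : 0 ≤ dirichletMajorant m B s K x :=
  (delta_nonneg s x).trans (delta_le_dirichletMajorant B s K x)

lemma dirichletMajorant_le_of_ne_zero (B K : ℕ) {s : ℕ} {x : G m} (hxs : x s ≠ 0) :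
    dirichletMajorant m B s K x ≤ (B + 1) * delta m s x := by
  have vanish (r : ℕ) (hr : r ∈ Finset.Ico s K) (hrs : r ≠ s) : delta m r x = 0 :=
    delta_of_notMem fun h => hxs (h s (lt_of_le_of_ne (Finset.mem_Ico.1 hr).1 hrs.symm))
  have single : ∑ r ∈ Finset.Ico s K, delta m r x ≤ delta m s x := by
    rcases lt_or_ge s K with h | h
    · exact (Finset.sum_eq_single_of_mem s (Finset.left_mem_Ico.2 h) vanish).le
    · simpa [Finset.Ico_eq_empty_of_le h] using delta_nonneg s x
  rw [add_one_mul, add_comm, dirichletMajorant]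
  gcongr

variable [∀ k, NeZero (m k)]

lemma integrable_dirichletMajorant (B s K : ℕ) :
    Integrable (dirichletMajorant m B s K) (haar m) :=
  (integrable_delta s).add ((integrable_finsetSum _ fun r _ => integrable_delta r).const_mul _)

lemma integral_dirichletMajorant (B s K : ℕ) :
    ∫ x, dirichletMajorant m B s K x ∂haar m = 1 + B * (K - s : ℕ) := by
  unfold dirichletMajorant
  rw [integral_add (integrable_delta s)
      ((integrable_finsetSum _ fun r _ => integrable_delta r).const_mul _),
    integral_const_mul, integral_finsetSum _ fun r _ => integrable_delta r]
  simp [integral_delta]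

lemma norm_dirichlet_le_dirichletMajorant (hm : ∀ k, 2 ≤ m k) {B : ℕ} (hB : ∀ k, m k ≤ B)
    {s K j : ℕ} (hs : s ≤ K) (hj : j ≤ M m K) {x : G m} (hx : x ∈ I m s 0) :
    ‖dirichlet m j x‖ ≤ dirichletMajorant m B s K x := by
  induction K, hs using Nat.le_induction generalizing j with
  | base =>
    rw [dirichlet_of_mem_I hj hx, Complex.norm_natCast]
    calc (j : ℝ) ≤ M m s := by exact_mod_cast hj
      _ = delta m s x := (delta_of_mem hx).symm
      _ ≤ dirichletMajorant m B s s x := delta_le_dirichletMajorant B s s x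
  | succ K hs ih =>
    set N := j / M m K
    have hN : (N : ℝ) ≤ B := by
      exact_mod_cast (Nat.div_le_of_le_mul (by rwa [mul_comm])).trans (hB K)
    have hl : j % M m K ≤ M m K := (Nat.mod_lt _ (M_pos K)).le
    calc ‖dirichlet m j x‖
        = ‖dirichlet m (N * M m K) x + psi m (N * M m K) x * dirichlet m (j % M m K) x‖ := by
          rw [← dirichlet_mul_M_add hm _ _ hl, Nat.div_add_mod']
      _ ≤ N * delta m K x + dirichletMajorant m B s K x := by
          refine (norm_add_le _ _).trans (add_le_add (norm_dirichlet_mul_M_le hm N K x) ?_)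
          rw [norm_mul, norm_psi, one_mul]
          exact ih hl
      _ ≤ B * delta m K x + dirichletMajorant m B s K x := by
          have := delta_nonneg K x
          gcongr
      _ = dirichletMajorant m B s (K + 1) x := by
          rw [dirichletMajorant, dirichletMajorant, Finset.sum_Ico_succ_top hs]
          ring

end DirichletMajorant

section QuadKernel

variable {m : ℕ → ℕ}

/-- The kernel `∑_{j < J} c_j D_j ⊗ D_j` of the weighted sum `∑_{j < J} c_j S_{j,j}` of quadratic
partial sums. -/
noncomputable def quadKernel (m : ℕ → ℕ) (c : ℕ → ℝ) (J : ℕ) (x y : G m) : ℂ :=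
  ∑ j ∈ Finset.range J, (c j : ℂ) * (dirichlet m j x * dirichlet m j y)

/-- The kernel `∑_i A_i^{-α-1} D_{n-i} ⊗ D_{n-i}` of the unnormalized `(C, -α)` means. -/
noncomputable def cesaroKernel (m : ℕ → ℕ) (α : ℝ) (n : ℕ) (x y : G m) : ℂ :=
  ∑ i ∈ Finset.range (n + 1),
    (cesaroA (-α - 1) i : ℂ) * (dirichlet m (n - i) x * dirichlet m (n - i) y)

lemma quadKernel_comm (c : ℕ → ℝ) (J : ℕ) (x y : G m) :
    quadKernel m c J x y = quadKernel m c J y x := by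
  simp only [quadKernel, mul_comm (dirichlet m _ x)]

lemma cesaroKernel_eq_quadKernel (α : ℝ) (n : ℕ) (x y : G m) :
    cesaroKernel m α n x y = quadKernel m (fun j => cesaroA (-α - 1) (n - j)) (n + 1) x y := by
  rw [cesaroKernel, quadKernel, ← Finset.sum_range_reflect]
  refine Finset.sum_congr rfl fun j hj => ?_
  have : j ≤ n := Nat.lt_succ_iff.1 (Finset.mem_range.1 hj)
  rw [Nat.add_sub_cancel, Nat.sub_sub_self this]

lemma cesaroKernel_eq_sum_range (α : ℝ) {n R : ℕ} (hR : n < R) (x y : G m) :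
    cesaroKernel m α n x y = ∑ i ∈ Finset.range R,
      (cesaroA (-α - 1) i : ℂ) * (dirichlet m (n - i) x * dirichlet m (n - i) y) := by
  refine Finset.sum_subset (Finset.range_mono hR) fun i _ hi => ?_
  rw [Nat.sub_eq_zero_of_le (by simp only [Finset.mem_range] at hi; omega), dirichlet_zero,
    zero_mul, mul_zero]

variable [∀ k, NeZero (m k)]

lemma measurable_quadKernel (c : ℕ → ℝ) (J : ℕ) :
    Measurable fun z : G m × G m => quadKernel m c J z.1 z.2 := by
  unfold quadKernel
  fun_prop

lemma integrable_quadKernel (c : ℕ → ℝ) (J : ℕ) :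
    Integrable (fun z : G m × G m => quadKernel m c J z.1 z.2) (haar2 m) := by
  refine integrable_finsetSum _ fun j _ => Integrable.const_mul ?_ _
  refine .of_bound (by fun_prop) ((j : ℝ) * j) (.of_forall fun z => ?_)
  rw [norm_mul]
  gcongr <;> exact norm_dirichlet_le j _

end QuadKernel

section CesaroSums

lemma norm_sum_ofReal_mul_le {ι : Type*} (S : Finset ι) (w : ι → ℝ) {P : ι → ℂ} {b : ι → ℝ}
    (h : ∀ i ∈ S, ‖P i‖ ≤ b i) : ‖∑ i ∈ S, (w i : ℂ) * P i‖ ≤ ∑ i ∈ S, |w i| * b i := by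
  refine norm_sum_le_of_le S fun i hi => ?_
  rw [norm_mul, Complex.norm_real, Real.norm_eq_abs]
  exact mul_le_mul_of_nonneg_left (h i hi) (abs_nonneg _)

variable {α : ℝ} (h0 : 0 ≤ α) (h1 : α < 1)
include h0 h1

lemma norm_sum_Ico_cesaroA_mul_le (a R : ℕ) {P : ℕ → ℂ} {C : ℝ} (hP : ∀ i, ‖P i‖ ≤ C) :
    ‖∑ i ∈ Finset.Ico (a + 1) R, (cesaroA (-α - 1) i : ℂ) * P i‖ ≤ ((a : ℝ) + 1) ^ (-α) * C := by
  refine (norm_sum_ofReal_mul_le _ _ fun i _ => hP i).trans ?_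
  rw [← Finset.sum_mul]
  exact mul_le_mul_of_nonneg_right (sum_Ico_abs_cesaroA_le h0 h1 a R) ((norm_nonneg _).trans (hP 0))

lemma norm_sum_range_cesaroA_mul_le_of_norm_le_mul (q : ℕ) {P : ℕ → ℂ} {D : ℝ} (hD : 0 ≤ D)
    (h : ∀ i ≤ q, ‖P i‖ ≤ D * i) :
    ‖∑ i ∈ Finset.range (q + 1), (cesaroA (-α - 1) i : ℂ) * P i‖
      ≤ D * ((q : ℝ) ^ (1 - α) / (1 - α)) := by
  calc _ ≤ ∑ i ∈ Finset.range (q + 1), |cesaroA (-α - 1) i| * (D * i) :=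
        norm_sum_ofReal_mul_le _ _ fun i hi => h i (Nat.lt_succ_iff.1 (Finset.mem_range.1 hi))
    _ = D * ∑ i ∈ Finset.range (q + 1), |cesaroA (-α - 1) i| * i := by
        simp only [Finset.mul_sum, mul_left_comm]
    _ ≤ _ := mul_le_mul_of_nonneg_left (sum_range_abs_cesaroA_mul_le h0 h1 q) hD

/-- The weights `A_i^{-α-1}` sum to `A_q^{-α}`, which is small, so a slowly varying sequence is
summed with much cancellation. -/
lemma norm_sum_range_cesaroA_mul_le_of_lipschitz (q : ℕ) {P : ℕ → ℂ} {D : ℝ} (hD : 0 ≤ D)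
    (h : ∀ i ≤ q, ‖P i - P 0‖ ≤ D * i) :
    ‖∑ i ∈ Finset.range (q + 1), (cesaroA (-α - 1) i : ℂ) * P i‖
      ≤ ((q : ℝ) + 1) ^ (-α) * ‖P 0‖ + D * ((q : ℝ) ^ (1 - α) / (1 - α)) := by
  have split : ∑ i ∈ Finset.range (q + 1), (cesaroA (-α - 1) i : ℂ) * P i
      = (cesaroA (-α) q : ℂ) * P 0
        + ∑ i ∈ Finset.range (q + 1), (cesaroA (-α - 1) i : ℂ) * (P i - P 0) := by
    rw [← sum_range_cesaroA_sub_one, Complex.ofReal_sum, Finset.sum_mul, ← Finset.sum_add_distrib]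
    simp only [← mul_add, add_sub_cancel]
  rw [split]
  refine norm_add_le_of_le ?_ (norm_sum_range_cesaroA_mul_le_of_norm_le_mul h0 h1 q hD h)
  rw [norm_mul, Complex.norm_real, Real.norm_of_nonneg (cesaroA_neg_pos h1 q).le]
  gcongr
  exact cesaroA_neg_le h0 h1 q

end CesaroSums

section CesaroKernelPointwise

variable {m : ℕ → ℕ} {α : ℝ} {n s : ℕ} {x y : G m} [∀ k, NeZero (m k)]

/-- The Dirichlet kernel `D_{n - i}(x)` vanishes at `i = n % M_s` when `n_s = 0`, and is
`1`-Lipschitz in `i` on the two adjacent blocks. -/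
lemma norm_dirichlet_le_abs_sub (hm : ∀ k, 2 ≤ m k) {i : ℕ} (hd : digit m n s = 0)
    (hx : x ∈ I m s 0) (hxs : x s ≠ 0) (hi : i ≤ n % M m s + M m s) :
    ‖dirichlet m (n - i) x‖ ≤ |((n % M m s : ℕ) : ℝ) - i| := by
  rcases le_total n i with hni | hin
  · simp [Nat.sub_eq_zero_of_le hni, dirichlet_zero]
  have hn : n = n / M m s * M m s + n % M m s := (Nat.div_add_mod' n _).symm
  have hq : n % M m s < M m s := Nat.mod_lt _ (M_pos s)
  have vanish : dirichlet m (n / M m s * M m s) x = 0 := by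
    obtain ⟨N, hN⟩ : m s ∣ n / M m s := Nat.dvd_of_mod_eq_zero hd
    have : n / M m s * M m s = N * M m (s + 1) := by rw [hN, M]; ring
    rw [this, dirichlet_mul_M_eq_zero hm _ hxs]
  rcases le_or_gt i (n % M m s) with h | h
  · have e : n - i = n / M m s * M m s + (n % M m s - i) := by omega
    rw [e, dirichlet_mul_M_add_of_mem_I hm _ (by omega) hx, vanish, zero_add, norm_mul, norm_psi,
      one_mul, Complex.norm_natCast, Nat.cast_sub h]
    exact le_abs_self _
  · obtain ⟨N, hN⟩ : ∃ N, n / M m s = N + 1 := by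
      refine Nat.exists_eq_add_one_of_ne_zero fun h0 => ?_
      rw [h0] at hn
      omega
    rw [hN, Nat.succ_mul] at vanish hn
    have e : n - i = N * M m s + (M m s - (i - n % M m s)) := by omega
    have lipschitz := norm_dirichlet_sub_le hm N (l := M m s) (l' := M m s - (i - n % M m s))
      le_rfl (Nat.sub_le _ _) hx
    rw [vanish, sub_zero, ← e, Nat.cast_sub (by omega), sub_sub_cancel,
      Nat.cast_sub h.le] at lipschitz
    rw [abs_sub_comm]
    exact lipschitz.trans (le_abs_self _)

variable (h0 : 0 ≤ α) (h1 : α < 1) (hm : ∀ k, 2 ≤ m k) {X L : ℝ}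
include h0 h1 hm

lemma norm_sum_range_cesaroA_mul_dirichlet_le (hx : x ∈ I m s 0) (hy : y ∈ I m s 0)
    (hX : ‖dirichlet m n x‖ ≤ X) (hL : ∀ j ≤ n, ‖dirichlet m j y‖ ≤ L) :
    ‖∑ i ∈ Finset.range (n % M m s + 1),
      (cesaroA (-α - 1) i : ℂ) * (dirichlet m (n - i) x * dirichlet m (n - i) y)‖
        ≤ (((n % M m s : ℕ) : ℝ) + 1) ^ (-α) * (‖dirichlet m n x‖ * L)
          + (L + X) * ((M m s : ℝ) ^ (1 - α) / (1 - α)) := by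
  have hn : n = n / M m s * M m s + n % M m s := (Nat.div_add_mod' n _).symm
  have hq : n % M m s ≤ M m s := (Nat.mod_lt _ (M_pos s)).le
  set q := n % M m s
  have hL0 : 0 ≤ L := (norm_nonneg _).trans (hL n le_rfl)
  have hX0 : 0 ≤ X := (norm_nonneg _).trans hX
  have dirichlet_lipschitz {u : G m} (hu : u ∈ I m s 0) {i : ℕ} (hi : i ≤ q) :
      ‖dirichlet m (n - i) u - dirichlet m n u‖ ≤ i := by
    have e : n - i = n / M m s * M m s + (q - i) := by omega
    have h := norm_dirichlet_sub_le hm (n / M m s) hq (Nat.sub_le q i) hu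
    rwa [← e, ← hn, Nat.cast_sub hi, sub_sub_cancel] at h
  have : 0 ≤ 1 - α := sub_nonneg.2 h1.le
  refine (norm_sum_range_cesaroA_mul_le_of_lipschitz h0 h1 q
    (P := fun i => dirichlet m (n - i) x * dirichlet m (n - i) y)
    (add_nonneg hL0 hX0) ?_).trans ?_
  · intro i hi
    calc ‖dirichlet m (n - i) x * dirichlet m (n - i) y - dirichlet m n x * dirichlet m n y‖
        = ‖(dirichlet m (n - i) x - dirichlet m n x) * dirichlet m (n - i) y
            + dirichlet m n x * (dirichlet m (n - i) y - dirichlet m n y)‖ := by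
          congr 1; ring
      _ ≤ i * L + X * i := by
          refine norm_add_le_of_le (norm_mul_le_of_le (dirichlet_lipschitz hx hi) ?_)
            (norm_mul_le_of_le hX (dirichlet_lipschitz hy hi))
          exact hL _ (Nat.sub_le _ _)
      _ = (L + X) * i := by ring
  · simp only [Nat.sub_zero, norm_mul]
    gcongr
    exact hL n le_rfl

lemma norm_sum_Ico_cesaroA_mul_dirichlet_le (hd : digit m n s = 0) (hx : x ∈ I m s 0)
    (hxs : x s ≠ 0) (hL : ∀ j ≤ n, ‖dirichlet m j y‖ ≤ L) :
    ‖∑ i ∈ Finset.Ico (n % M m s + 1) (n % M m s + M m s + 1),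
      (cesaroA (-α - 1) i : ℂ) * (dirichlet m (n - i) x * dirichlet m (n - i) y)‖
        ≤ L * (2 * (M m s : ℝ) ^ (1 - α) / (1 - α)) := by
  have hq : n % M m s < M m s := Nat.mod_lt _ (M_pos s)
  set q := n % M m s with hq_def
  have hL0 : 0 ≤ L := (norm_nonneg _).trans (hL n le_rfl)
  have : 0 ≤ 1 - α := sub_nonneg.2 h1.le
  have term_le (i : ℕ) (hi : i ∈ Finset.Ico (q + 1) (q + M m s + 1)) :
      ‖dirichlet m (n - i) x * dirichlet m (n - i) y‖ ≤ i * L := by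
    obtain ⟨hqi, hiq⟩ := Finset.mem_Ico.1 hi
    have hqi' : (q : ℝ) ≤ i := by exact_mod_cast (Nat.le_succ q).trans hqi
    refine norm_mul_le_of_le ?_ (hL _ (Nat.sub_le _ _))
    refine (norm_dirichlet_le_abs_sub hm hd hx hxs (Nat.lt_succ_iff.1 hiq)).trans ?_
    rw [← hq_def, abs_of_nonpos (sub_nonpos.2 hqi'), neg_sub]
    exact sub_le_self _ q.cast_nonneg
  have rpow_le : ((q + M m s : ℕ) : ℝ) ^ (1 - α) ≤ 2 * (M m s : ℝ) ^ (1 - α) := by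
    calc ((q + M m s : ℕ) : ℝ) ^ (1 - α) ≤ ((2 * M m s : ℕ) : ℝ) ^ (1 - α) := by
          gcongr; omega
      _ = 2 ^ (1 - α) * (M m s : ℝ) ^ (1 - α) := by
          rw [Nat.cast_mul, Real.mul_rpow (by positivity) (by positivity), Nat.cast_ofNat]
      _ ≤ 2 ^ (1 : ℝ) * (M m s : ℝ) ^ (1 - α) := by gcongr <;> linarith
      _ = _ := by rw [Real.rpow_one]
  calc _ ≤ ∑ i ∈ Finset.Ico (q + 1) (q + M m s + 1), |cesaroA (-α - 1) i| * (i * L) :=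
        norm_sum_ofReal_mul_le _ _ term_le
    _ ≤ ∑ i ∈ Finset.range (q + M m s + 1), |cesaroA (-α - 1) i| * (i * L) := by
        refine Finset.sum_le_sum_of_subset_of_nonneg ?_ fun i _ _ => by positivity
        exact (Finset.Ico_subset_Ico_left (Nat.zero_le _)).trans_eq (Finset.range_eq_Ico _).symm
    _ = L * ∑ i ∈ Finset.range (q + M m s + 1), |cesaroA (-α - 1) i| * i := by
        rw [Finset.mul_sum]
        exact Finset.sum_congr rfl fun i _ => by ring
    _ ≤ L * (((q + M m s : ℕ) : ℝ) ^ (1 - α) / (1 - α)) := by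
        gcongr
        exact sum_range_abs_cesaroA_mul_le h0 h1 _
    _ ≤ L * (2 * (M m s : ℝ) ^ (1 - α) / (1 - α)) := by gcongr

lemma norm_cesaroKernel_le_add (hx : x ∈ I m s 0) (hy : y ∈ I m s 0)
    (hX : ∀ j ≤ n, ‖dirichlet m j x‖ ≤ X) (hL : ∀ j ≤ n, ‖dirichlet m j y‖ ≤ L) :
    ‖cesaroKernel m α n x y‖ ≤ 2 * (X * L) * (((n % M m s : ℕ) : ℝ) + 1) ^ (-α)
      + (L + X) * ((M m s : ℝ) ^ (1 - α) / (1 - α)) := by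
  have hL0 : 0 ≤ L := (norm_nonneg _).trans (hL n le_rfl)
  have head := norm_sum_range_cesaroA_mul_dirichlet_le h0 h1 hm hx hy (hX n le_rfl) hL
  have tail := norm_sum_Ico_cesaroA_mul_le h0 h1 (n % M m s) (n + 1)
    fun i => norm_mul_le_of_le (hX (n - i) (Nat.sub_le n i)) (hL (n - i) (Nat.sub_le n i))
  have head_le : (((n % M m s : ℕ) : ℝ) + 1) ^ (-α) * (‖dirichlet m n x‖ * L)
      ≤ (((n % M m s : ℕ) : ℝ) + 1) ^ (-α) * (X * L) := by
    gcongr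
    exact hX n le_rfl
  rw [cesaroKernel, ← Finset.sum_range_add_sum_Ico _ (Nat.succ_le_succ (Nat.mod_le n (M m s)))]
  refine (norm_add_le _ _).trans ?_
  linarith

lemma norm_cesaroKernel_le_of_digit_eq_zero (hd : digit m n s = 0) (hx : x ∈ I m s 0)
    (hxs : x s ≠ 0) (hy : y ∈ I m s 0)
    (hX : ∀ j ≤ n, ‖dirichlet m j x‖ ≤ X) (hL : ∀ j ≤ n, ‖dirichlet m j y‖ ≤ L) :
    ‖cesaroKernel m α n x y‖ ≤ X * L * (M m s : ℝ) ^ (-α)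
      + L * (M m s : ℝ) ^ (1 - α) + (3 * L + X) * ((M m s : ℝ) ^ (1 - α) / (1 - α)) := by
  have hL0 : 0 ≤ L := (norm_nonneg _).trans (hL n le_rfl)
  have hX0 : 0 ≤ X := (norm_nonneg _).trans (hX n le_rfl)
  have hq : n % M m s < M m s := Nat.mod_lt _ (M_pos s)
  have hMs : (0 : ℝ) < M m s := by exact_mod_cast M_pos s
  have head := norm_sum_range_cesaroA_mul_dirichlet_le h0 h1 hm hx hy (hX n le_rfl) hL
  have middle := norm_sum_Ico_cesaroA_mul_dirichlet_le h0 h1 hm hd hx hxs hL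
  have tail := norm_sum_Ico_cesaroA_mul_le h0 h1 (n % M m s + M m s) (n + M m s + 1)
    fun i => norm_mul_le_of_le (hX (n - i) (Nat.sub_le n i)) (hL (n - i) (Nat.sub_le n i))
  have norm_dirichlet_le : ‖dirichlet m n x‖ ≤ ((n % M m s : ℕ) : ℝ) + 1 := by
    have := norm_dirichlet_le_abs_sub hm hd hx hxs (Nat.zero_le _)
    rw [Nat.sub_zero, Nat.cast_zero, sub_zero, Nat.abs_cast] at this
    exact this.trans (le_add_of_nonneg_right zero_le_one)
  have head_le : (((n % M m s : ℕ) : ℝ) + 1) ^ (-α) * (‖dirichlet m n x‖ * L)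
      ≤ L * (M m s : ℝ) ^ (1 - α) := by
    calc _ ≤ (((n % M m s : ℕ) : ℝ) + 1) ^ (-α) * ((((n % M m s : ℕ) : ℝ) + 1) * L) := by gcongr
      _ = L * (((n % M m s : ℕ) : ℝ) + 1) ^ (1 - α) := by
          rw [sub_eq_neg_add, Real.rpow_add_one (by positivity)]; ring
      _ ≤ L * (M m s : ℝ) ^ (1 - α) := by
          have : 0 ≤ 1 - α := sub_nonneg.2 h1.le
          gcongr
          exact_mod_cast hq
  have tail_le : (((n % M m s + M m s : ℕ) : ℝ) + 1) ^ (-α) * (X * L)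
      ≤ X * L * (M m s : ℝ) ^ (-α) := by
    rw [mul_comm]
    refine mul_le_mul_of_nonneg_left (Real.rpow_le_rpow_of_nonpos hMs ?_ (neg_nonpos.2 h0))
      (mul_nonneg hX0 hL0)
    exact_mod_cast (Nat.le_add_left (M m s) (n % M m s)).trans (Nat.le_succ _)
  have hR : n % M m s + M m s + 1 ≤ n + M m s + 1 := by have := Nat.mod_le n (M m s); omega
  rw [cesaroKernel_eq_sum_range α (show n < n + M m s + 1 by omega),
    ← Finset.sum_range_add_sum_Ico _ hR,
    ← Finset.sum_range_add_sum_Ico _ (show n % M m s + 1 ≤ n % M m s + M m s + 1 by omega)]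
  refine (norm_add₃_le).trans (((add_le_add_three head middle tail)).trans ?_)
  linear_combination head_le + tail_le

end CesaroKernelPointwise

section ScaleBound

variable {m : ℕ → ℕ} {α : ℝ}

/-- The size of the Cesàro kernel `K_n` on `(I_s ∖ I_{s+1}) × I_s`, relative to that of the
kernels `D_j ⊗ D_j` of which it is made. -/
noncomputable def scaleBound (m : ℕ → ℕ) (α : ℝ) (n s : ℕ) : ℝ :=
  (if digit m n s = 0 then 0 else (((n % M m s : ℕ) : ℝ) + 1) ^ (-α)) + (M m s : ℝ) ^ (-α)

lemma scaleBound_nonneg (α : ℝ) (n s : ℕ) : 0 ≤ scaleBound m α n s := by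
  unfold scaleBound
  split_ifs <;> positivity

lemma M_rpow_neg_le (h0 : 0 ≤ α) (hm : ∀ k, 2 ≤ m k) (s : ℕ) :
    (M m s : ℝ) ^ (-α) ≤ (2 ^ (-α)) ^ s := by
  induction s with
  | zero => simp [M]
  | succ s ih =>
    rw [M, Nat.cast_mul, Real.mul_rpow (Nat.cast_nonneg _) (Nat.cast_nonneg _), pow_succ']
    have : (m s : ℝ) ^ (-α) ≤ 2 ^ (-α) :=
      Real.rpow_le_rpow_of_nonpos (by norm_num) (by exact_mod_cast hm s) (neg_nonpos.2 h0)
    gcongr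

/-- Each nonzero digit at least doubles `n % M_s + 1`, so the terms decrease geometrically. -/
lemma mul_sum_digit_rpow_neg_le (h0 : 0 ≤ α) (n K : ℕ) :
    (1 - 2 ^ (-α)) * ∑ s ∈ Finset.range K,
      (if digit m n s = 0 then 0 else (((n % M m s : ℕ) : ℝ) + 1) ^ (-α))
      ≤ 1 - (((n % M m K : ℕ) : ℝ) + 1) ^ (-α) := by
  induction K with
  | zero => simp [M, Nat.mod_one]
  | succ K ih =>
    rw [Finset.sum_range_succ, mul_add]
    split_ifs with hd
    · simpa [mod_M_succ, hd] using ih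
    · have doubling : 2 * (((n % M m K : ℕ) : ℝ) + 1) ≤ ((n % M m (K + 1) : ℕ) : ℝ) + 1 := by
        rcases Nat.eq_zero_or_pos (M m K) with hM | hM
        · simp [digit, hM] at hd
        have hlt : n % M m K < M m K := Nat.mod_lt _ hM
        have hle : M m K ≤ M m K * digit m n K := Nat.le_mul_of_pos_right _ (Nat.pos_of_ne_zero hd)
        rw [mod_M_succ]
        exact_mod_cast (by omega)
      have : (((n % M m (K + 1) : ℕ) : ℝ) + 1) ^ (-α)
          ≤ 2 ^ (-α) * (((n % M m K : ℕ) : ℝ) + 1) ^ (-α) := by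
        rw [← Real.mul_rpow (by norm_num) (by positivity)]
        exact Real.rpow_le_rpow_of_nonpos (by positivity) doubling (neg_nonpos.2 h0)
      linarith

lemma one_sub_two_rpow_neg_pos (h0 : 0 < α) : (0 : ℝ) < 1 - 2 ^ (-α) :=
  sub_pos.2 (Real.rpow_lt_one_of_one_lt_of_neg one_lt_two (neg_lt_zero.2 h0))

lemma sum_scaleBound_le (h0 : 0 < α) (hm : ∀ k, 2 ≤ m k) (n K : ℕ) :
    ∑ s ∈ Finset.range K, scaleBound m α n s ≤ 2 / (1 - 2 ^ (-α)) := by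
  have ht := one_sub_two_rpow_neg_pos h0
  have powers : (1 - 2 ^ (-α)) * ∑ s ∈ Finset.range K, (M m s : ℝ) ^ (-α) ≤ 1 := by
    calc _ ≤ (1 - 2 ^ (-α)) * ∑ s ∈ Finset.range K, ((2 : ℝ) ^ (-α)) ^ s := by
          gcongr with s
          exact M_rpow_neg_le h0.le hm s
      _ = 1 - ((2 : ℝ) ^ (-α)) ^ K := mul_neg_geom_sum _ K
      _ ≤ 1 := sub_le_self _ (by positivity)
  have digits := mul_sum_digit_rpow_neg_le (m := m) h0.le n K
  have : (0 : ℝ) ≤ (((n % M m K : ℕ) : ℝ) + 1) ^ (-α) := by positivity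
  rw [le_div_iff₀' ht]
  simp only [scaleBound, Finset.sum_add_distrib, mul_add]
  linarith

variable [∀ k, NeZero (m k)]

lemma norm_cesaroKernel_le (h0 : 0 ≤ α) (h1 : α < 1) (hm : ∀ k, 2 ≤ m k) {B : ℕ}
    (hB : ∀ k, m k ≤ B) {s K n : ℕ} (hs : s ≤ K) (hn : n ≤ M m K) {x y : G m}
    (hx : x ∈ I m s 0) (hxs : x s ≠ 0) (hy : y ∈ I m s 0) :
    ‖cesaroKernel m α n x y‖ ≤ (2 * (B + 1) + (B + 4) / (1 - α)) *
      (scaleBound m α n s * (M m s * dirichletMajorant m B s K y)) := by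
  have : 0 < 1 - α := sub_pos.2 h1
  have hMs : (0 : ℝ) < M m s := by exact_mod_cast M_pos s
  set L := dirichletMajorant m B s K y
  have hML : M m s ≤ L := (delta_of_mem hy).symm.trans_le (delta_le_dirichletMajorant B s K y)
  have hL0 : 0 ≤ L := hMs.le.trans hML
  have hX (j : ℕ) (hj : j ≤ n) : ‖dirichlet m j x‖ ≤ (B + 1) * M m s :=
    delta_of_mem hx ▸ (norm_dirichlet_le_dirichletMajorant hm hB hs (hj.trans hn) hx).trans
      (dirichletMajorant_le_of_ne_zero B K hxs)
  have hL (j : ℕ) (hj : j ≤ n) : ‖dirichlet m j y‖ ≤ L :=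
    norm_dirichlet_le_dirichletMajorant hm hB hs (hj.trans hn) hy
  have hLX : L + (B + 1) * M m s ≤ (B + 2) * L := by
    linear_combination ((B : ℝ) + 1) * hML
  have rpow_eq : (M m s : ℝ) ^ (1 - α) = M m s * (M m s : ℝ) ^ (-α) := by
    rw [sub_eq_neg_add, Real.rpow_add_one hMs.ne', mul_comm]
  have hE : 0 ≤ (M m s : ℝ) ^ (1 - α) / (1 - α) := by positivity
  have hE' : 0 ≤ B * (M m s * L * (M m s : ℝ) ^ (-α)) := by positivity
  have hLE := mul_le_mul_of_nonneg_right hLX hE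
  rw [scaleBound]
  split_ifs with hd
  · refine (norm_cesaroKernel_le_of_digit_eq_zero h0 h1 hm hd hx hxs hy hX hL).trans ?_
    rw [rpow_eq] at hLE ⊢
    linear_combination hLE + hE'
  · refine (norm_cesaroKernel_le_add h0 h1 hm hx hy hX hL).trans ?_
    have hE2 : 0 ≤ 2 / (1 - α) * (M m s * L * (M m s : ℝ) ^ (-α)) := by positivity
    have hE3 : 0 ≤ (M m s * L * (M m s : ℝ) ^ (-α)) := by positivity
    have hE4 : 0 ≤ (B + 4) / (1 - α) * (M m s * L * (((n % M m s : ℕ) : ℝ) + 1) ^ (-α)) := by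
      positivity
    rw [rpow_eq] at hLE ⊢
    linear_combination hLE + hE2 + 2 * hE' + 2 * hE3 + hE4

end ScaleBound

section ScaleDecomposition

lemma setIntegral_prod_self_le {X : Type*} [MeasurableSpace X] {μ : Measure X} [SFinite μ]
    {F : X × X → ℝ} (hF : Integrable F (μ.prod μ)) (hF0 : ∀ z, 0 ≤ F z)
    (hsymm : ∀ z, F z.swap = F z) {S T : Set X} (hS : MeasurableSet S) (hT : MeasurableSet T)
    (hTS : T ⊆ S) :
    ∫ z in S ×ˢ S, F z ∂μ.prod μ
      ≤ 2 * ∫ z in S ×ˢ (S \ T), F z ∂μ.prod μ + ∫ z in T ×ˢ T, F z ∂μ.prod μ := by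
  have split_snd : ∫ z in S ×ˢ S, F z ∂μ.prod μ
      = ∫ z in S ×ˢ (S \ T), F z ∂μ.prod μ + ∫ z in S ×ˢ T, F z ∂μ.prod μ := by
    rw [← setIntegral_union (Set.disjoint_prod.2 (.inr Set.disjoint_sdiff_left)) (hS.prod hT)
      hF.integrableOn hF.integrableOn, ← Set.prod_union, Set.sdiff_union_of_subset hTS]
  have split_fst : ∫ z in S ×ˢ T, F z ∂μ.prod μ
      = ∫ z in (S \ T) ×ˢ T, F z ∂μ.prod μ + ∫ z in T ×ˢ T, F z ∂μ.prod μ := by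
    rw [← setIntegral_union (Set.disjoint_prod.2 (.inl Set.disjoint_sdiff_left)) (hT.prod hT)
      hF.integrableOn hF.integrableOn, ← Set.union_prod, Set.sdiff_union_of_subset hTS]
  have corner : ∫ z in (S \ T) ×ˢ T, F z ∂μ.prod μ ≤ ∫ z in S ×ˢ (S \ T), F z ∂μ.prod μ :=
    calc _ ≤ ∫ z in (S \ T) ×ˢ S, F z ∂μ.prod μ :=
          setIntegral_mono_set hF.integrableOn (.of_forall hF0)
            (Set.prod_mono_right hTS).eventuallyLE
      _ = ∫ z in S ×ˢ (S \ T), F z ∂μ.prod μ := by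
          rw [← setIntegral_prod_swap]
          simp only [hsymm]
  linarith

variable {m : ℕ → ℕ}

/-- The points of `G_m` whose first nonzero coordinate is the `s`-th. -/
def annulus (m : ℕ → ℕ) (s : ℕ) : Set (G m) := I m s 0 \ I m (s + 1) 0

lemma mem_annulus {s : ℕ} {x : G m} : x ∈ annulus m s ↔ x ∈ I m s 0 ∧ x s ≠ 0 := by
  rw [annulus, Set.mem_sdiff, mem_I_succ, not_and]
  exact and_congr_right fun h => ⟨fun h' => h' h, fun h' _ => h'⟩

lemma add_mem_annulus_iff {s : ℕ} {e x : G m} (he : e ∈ I m (s + 1) 0) :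
    e + x ∈ annulus m s ↔ x ∈ annulus m s := by
  rw [annulus, Set.mem_sdiff, Set.mem_sdiff, add_mem_I_iff he,
    add_mem_I_iff (I_antitone s.le_succ 0 he)]

lemma measurableSet_annulus (s : ℕ) : MeasurableSet (annulus m s) :=
  (measurableSet_I s 0).diff (measurableSet_I (s + 1) 0)

variable [∀ k, NeZero (m k)]

lemma haar_real_annulus_le (s : ℕ) : (haar m).real (annulus m s) ≤ (M m s : ℝ)⁻¹ :=
  (measureReal_mono Set.sdiff_subset).trans_eq (haar_real_I s 0)

lemma setIntegral_annulus_le {s : ℕ} {f : G m → ℝ} {C : ℝ} (hC : 0 ≤ C)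
    (hf : ∀ x ∈ annulus m s, |f x| ≤ C) :
    ∫ x in annulus m s, f x ∂haar m ≤ C * (M m s : ℝ)⁻¹ :=
  (Real.le_norm_self _).trans <|
    (norm_setIntegral_le_of_norm_le_const (measure_lt_top (haar m) _) hf).trans <|
      mul_le_mul_of_nonneg_left (haar_real_annulus_le s) hC

lemma norm_quadKernel_le (c : ℕ → ℝ) {J R : ℕ} (hJ : J ≤ R + 1) (x y : G m) :
    ‖quadKernel m c J x y‖ ≤ (∑ j ∈ Finset.range J, |c j|) * R ^ 2 := by
  rw [Finset.sum_mul]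
  refine norm_sum_ofReal_mul_le _ _ fun j hj => ?_
  have hjR : (j : ℝ) ≤ R := by
    exact_mod_cast Nat.lt_succ_iff.1 ((Finset.mem_range.1 hj).trans_le hJ)
  rw [pow_two]
  exact norm_mul_le_of_le ((norm_dirichlet_le j x).trans hjR) ((norm_dirichlet_le j y).trans hjR)

lemma setIntegral_norm_quadKernel_prod_I_le (c : ℕ → ℝ) {J K : ℕ} (hJ : J ≤ M m K + 1) :
    ∫ z in I m K 0 ×ˢ I m K 0, ‖quadKernel m c J z.1 z.2‖ ∂haar2 m
      ≤ ∑ j ∈ Finset.range J, |c j| := by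
  have hM : (M m K : ℝ) ≠ 0 := by exact_mod_cast (M_pos K).ne'
  refine (le_abs_self _).trans ((norm_setIntegral_le_of_norm_le_const (measure_lt_top _ _)
    fun z _ => (norm_norm _).trans_le (norm_quadKernel_le c hJ z.1 z.2)).trans_eq ?_)
  rw [haar2, measureReal_prod_prod, haar_real_I]
  field_simp

lemma integral_norm_quadKernel_le_sum (c : ℕ → ℝ) (J K : ℕ) :
    ∫ z, ‖quadKernel m c J z.1 z.2‖ ∂haar2 m
      ≤ 2 * ∑ s ∈ Finset.range K,
          ∫ y in I m s 0, ∫ x in annulus m s, ‖quadKernel m c J y x‖ ∂haar m ∂haar m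
        + ∫ z in I m K 0 ×ˢ I m K 0, ‖quadKernel m c J z.1 z.2‖ ∂haar2 m := by
  have hF := (integrable_quadKernel (m := m) c J).norm
  induction K with
  | zero =>
    have : I m 0 0 = Set.univ := Set.eq_univ_of_forall fun _ _ hj => absurd hj (Nat.not_lt_zero _)
    simp [this]
  | succ K ih =>
    have peel := setIntegral_prod_self_le hF (fun _ => norm_nonneg _)
      (fun z => by rw [z.fst_swap, z.snd_swap, quadKernel_comm]) (measurableSet_I K 0)
      (measurableSet_I (K + 1) 0) (I_antitone K.le_succ 0)
    rw [Finset.sum_range_succ, ← setIntegral_prod (fun z => ‖quadKernel m c J z.1 z.2‖)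
      hF.integrableOn, mul_add, add_assoc]
    exact ih.trans (add_le_add_right peel _)

lemma integral_norm_quadKernel_le_of_forall_annulus (c : ℕ → ℝ) {J K : ℕ} (hJ : J ≤ M m K + 1)
    (B : ℕ) {C : ℕ → ℝ} (hC0 : ∀ s, 0 ≤ C s) (hC : ∀ s < K, ∀ y ∈ I m s 0,
      ∫ x in annulus m s, ‖quadKernel m c J x y‖ ∂haar m ≤ C s * dirichletMajorant m B s K y) :
    ∫ z, ‖quadKernel m c J z.1 z.2‖ ∂haar2 m
      ≤ 2 * ∑ s ∈ Finset.range K, C s * (1 + B * (K - s : ℕ)) + ∑ j ∈ Finset.range J, |c j| := by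
  refine (integral_norm_quadKernel_le_sum c J K).trans ?_
  gcongr with s hs
  · have majorant_nonneg (y : G m) : 0 ≤ C s * dirichletMajorant m B s K y :=
      mul_nonneg (hC0 s) (dirichletMajorant_nonneg B s K y)
    have majorant_integrable := (integrable_dirichletMajorant (m := m) B s K).const_mul (C s)
    calc _ ≤ ∫ y in I m s 0, C s * dirichletMajorant m B s K y ∂haar m := by
          refine integral_mono_of_nonneg
            (.of_forall fun y => integral_nonneg fun x => norm_nonneg _)
            majorant_integrable.integrableOn
            (ae_restrict_of_forall_mem (measurableSet_I s 0) ?_)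
          simpa only [quadKernel_comm c J _ _] using hC s (Finset.mem_range.1 hs)
      _ ≤ ∫ y, C s * dirichletMajorant m B s K y ∂haar m :=
          setIntegral_le_integral majorant_integrable (.of_forall majorant_nonneg)
      _ = C s * (1 + B * (K - s : ℕ)) := by
          rw [integral_const_mul, integral_dirichletMajorant]
  · exact setIntegral_norm_quadKernel_prod_I_le c hJ

lemma setIntegral_annulus_norm_cesaroKernel_le {α : ℝ} (h0 : 0 ≤ α) (h1 : α < 1)
    (hm : ∀ k, 2 ≤ m k) {B : ℕ} (hB : ∀ k, m k ≤ B) {s K n : ℕ} (hs : s ≤ K) (hn : n ≤ M m K)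
    {y : G m} (hy : y ∈ I m s 0) :
    ∫ x in annulus m s, ‖cesaroKernel m α n x y‖ ∂haar m
      ≤ (2 * (B + 1) + (B + 4) / (1 - α)) * scaleBound m α n s * dirichletMajorant m B s K y := by
  have : 0 < 1 - α := sub_pos.2 h1
  have hM : (M m s : ℝ) ≠ 0 := by exact_mod_cast (M_pos s).ne'
  set b := (2 * (B + 1) + (B + 4) / (1 - α)) *
    (scaleBound m α n s * (M m s * dirichletMajorant m B s K y))
  have hb : 0 ≤ b := by
    have := scaleBound_nonneg (m := m) α n s
    have := dirichletMajorant_nonneg B s K y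
    positivity
  calc _ ≤ b * (M m s : ℝ)⁻¹ := by
        refine setIntegral_annulus_le hb fun x hx => ?_
        rw [mem_annulus] at hx
        rw [abs_norm]
        exact norm_cesaroKernel_le h0 h1 hm hB hs hn hx.1 hx.2 hy
    _ = _ := by
        simp only [b]
        field_simp

/-- The factor in front of `K + 1` in the bound for the `L^1` norms of the Cesàro kernels. -/
noncomputable def cesaroConst (B : ℕ) (α : ℝ) : ℝ :=
  2 * ((2 * (B + 1) + (B + 4) / (1 - α)) * (2 / (1 - 2 ^ (-α))) * (B + 1)) + 2

lemma cesaroConst_nonneg (B : ℕ) {α : ℝ} (h0 : 0 < α) (h1 : α < 1) : 0 ≤ cesaroConst B α := by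
  have : 0 < 1 - α := sub_pos.2 h1
  have := one_sub_two_rpow_neg_pos h0
  unfold cesaroConst
  positivity

lemma integral_norm_cesaroKernel_le {α : ℝ} (h0 : 0 < α) (h1 : α < 1) (hm : ∀ k, 2 ≤ m k) {B : ℕ}
    (hB : ∀ k, m k ≤ B) {n K : ℕ} (hn : n ≤ M m K) :
    ∫ z, ‖cesaroKernel m α n z.1 z.2‖ ∂haar2 m ≤ cesaroConst B α * (K + 1) := by
  have : 0 < 1 - α := sub_pos.2 h1
  set C : ℝ := 2 * (B + 1) + (B + 4) / (1 - α)
  have hC0 : 0 ≤ C := by positivity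
  have majorants (s : ℕ) : (1 + B * (K - s : ℕ) : ℝ) ≤ (B + 1) * (K + 1) := by
    have : ((K - s : ℕ) : ℝ) ≤ K := by exact_mod_cast K.sub_le s
    linear_combination (B : ℝ) * this + (B.cast_nonneg : (0 : ℝ) ≤ B) +
      (K.cast_nonneg : (0 : ℝ) ≤ K)
  simp only [cesaroKernel_eq_quadKernel]
  calc _ ≤ 2 * ∑ s ∈ Finset.range K, C * scaleBound m α n s * (1 + B * (K - s : ℕ)) + 2 :=
        (integral_norm_quadKernel_le_of_forall_annulus _ (Nat.add_le_add_right hn 1) B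
          (fun s => mul_nonneg hC0 (scaleBound_nonneg α n s)) fun s hs y hy => by
            simpa only [cesaroKernel_eq_quadKernel] using
              setIntegral_annulus_norm_cesaroKernel_le h0.le h1 hm hB hs.le hn hy).trans
          (add_le_add_right (sum_range_abs_cesaroA_sub_le h0.le h1 n) _)
    _ ≤ 2 * ∑ s ∈ Finset.range K, C * scaleBound m α n s * ((B + 1) * (K + 1)) + 2 := by
        gcongr with s
        · exact mul_nonneg hC0 (scaleBound_nonneg α n s)
        · exact majorants s
    _ = 2 * (C * (∑ s ∈ Finset.range K, scaleBound m α n s) * (B + 1)) * (K + 1) + 2 := by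
        rw [← Finset.sum_mul, ← Finset.mul_sum]
        ring
    _ ≤ 2 * (C * (2 / (1 - 2 ^ (-α))) * (B + 1)) * (K + 1) + 2 * (K + 1) := by
        gcongr
        · exact sum_scaleBound_le h0 hm n K
        · linarith [(K.cast_nonneg : (0 : ℝ) ≤ K)]
    _ = cesaroConst B α * (K + 1) := by
        rw [cesaroConst]
        ring

end ScaleDecomposition

section Bessel

lemma integral_norm_le_sqrt {X E : Type*} [MeasurableSpace X] [NormedAddCommGroup E]
    {μ : Measure X} [IsFiniteMeasure μ] {f : X → E} (hf : MemLp f 2 μ) :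
    ∫ x, ‖f x‖ ∂μ ≤ √(μ.real Set.univ * ∫ x, ‖f x‖ ^ 2 ∂μ) := by
  have holder := integral_mul_le_Lp_mul_Lq_of_nonneg (μ := μ) .two_two
    (.of_forall fun _ => zero_le_one) (.of_forall fun x => norm_nonneg (f x))
    (memLp_const 1) (by simpa using hf.norm)
  rw [Real.sqrt_mul measureReal_nonneg, Real.sqrt_eq_rpow, Real.sqrt_eq_rpow]
  simpa using holder

variable {m : ℕ → ℕ} [∀ k, NeZero (m k)]

lemma integral_norm_sq_sum_mul_psi (hm : ∀ k, 2 ≤ m k) (t Q : ℕ) {b : ℕ → G m → ℂ}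
    (hb : ∀ N < Q, MemLp (b N) 2 (haar m))
    (hinv : ∀ N < Q, ∀ e ∈ I m t 0, ∀ x, b N (e + x) = b N x) :
    ∫ x, ‖∑ N ∈ Finset.range Q, b N x * psi m (N * M m t) x‖ ^ 2 ∂haar m
      = ∑ N ∈ Finset.range Q, ∫ x, ‖b N x‖ ^ 2 ∂haar m := by
  have norm_sq (z : ℂ) : ((‖z‖ ^ 2 : ℝ) : ℂ) = z * (starRingEnd ℂ) z := by
    rw [Complex.mul_conj, Complex.normSq_eq_norm_sq]
  let pairing (N N' : ℕ) (x : G m) : ℂ := b N x * (starRingEnd ℂ) (b N' x) *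
    (psi m (N * M m t) x * (starRingEnd ℂ) (psi m (N' * M m t) x))
  have pairing_integrable {N N' : ℕ} (hN : N < Q) (hN' : N' < Q) :
      Integrable (pairing N N') (haar m) :=
    ((hb N hN).integrable_mul (hb N' hN').star).mul_bdd (c := 1) (by fun_prop)
      (.of_forall fun x => by rw [norm_mul, RCLike.norm_conj, norm_psi, norm_psi, one_mul])
  have expand (x : G m) : (‖∑ N ∈ Finset.range Q, b N x * psi m (N * M m t) x‖ ^ 2 : ℂ)
      = ∑ N ∈ Finset.range Q, ∑ N' ∈ Finset.range Q, pairing N N' x := by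
    rw [← Complex.ofReal_pow, norm_sq, map_sum, Finset.sum_mul_sum]
    simp only [map_mul, pairing, mul_mul_mul_comm]
  have diagonal {N : ℕ} (x : G m) : pairing N N x = (‖b N x‖ ^ 2 : ℝ) := by
    simp only [pairing, psi_mul_conj_psi, mul_one, norm_sq]
  have off_diagonal {N N' : ℕ} (hN : N < Q) (hN' : N' < Q) (hne : N' ≠ N) :
      ∫ x, pairing N N' x ∂haar m = 0 :=
    integral_mul_psi_mul_conj_psi hm (fun h => hne (Nat.eq_of_mul_eq_mul_right (M_pos t) h).symm)
      (Dvd.intro_left N rfl) (Dvd.intro_left N' rfl) fun e he x => by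
        rw [hinv N hN e he, hinv N' hN' e he]
  rw [← Complex.ofReal_inj, Complex.ofReal_sum]
  simp only [← integral_complex_ofReal, Complex.ofReal_pow, expand]
  rw [integral_finsetSum _ fun N hN => integrable_finsetSum _ fun N' hN' =>
    pairing_integrable (Finset.mem_range.1 hN) (Finset.mem_range.1 hN')]
  refine Finset.sum_congr rfl fun N hN => ?_
  have hN := Finset.mem_range.1 hN
  rw [integral_finsetSum _ fun N' hN' => pairing_integrable hN (Finset.mem_range.1 hN'),
    Finset.sum_eq_single_of_mem N (Finset.mem_range.2 hN) fun N' hN' =>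
      off_diagonal hN (Finset.mem_range.1 hN')]
  simp only [diagonal, Complex.ofReal_pow]

end Bessel

section QuadBlocks

lemma sum_range_mul_eq {E : Type*} [AddCommMonoid E] (f : ℕ → E) (Q T : ℕ) :
    ∑ j ∈ Finset.range (Q * T), f j
      = ∑ N ∈ Finset.range Q, ∑ l ∈ Finset.range T, f (N * T + l) := by
  induction Q with
  | zero => simp
  | succ Q ih => rw [Nat.succ_mul, Finset.sum_range_add, ih, Finset.sum_range_succ]

variable {m : ℕ → ℕ}

/-- The coefficient of `ψ_{N M_t}(x)` in the expansion of the kernel `∑_j c_j D_j(x) D_j(y)` on the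
annulus `I_{t-1} \ I_t`. As a function of `x` it is invariant under `I_t`. -/
noncomputable def quadBlock (m : ℕ → ℕ) (c : ℕ → ℝ) (t N : ℕ) (x y : G m) : ℂ :=
  ∑ l ∈ Finset.range (M m t),
    (c (N * M m t + l) : ℂ) * (dirichlet m l x * dirichlet m (N * M m t + l) y)

variable [∀ k, NeZero (m k)]

lemma memLp_dirichlet (p : ℝ≥0∞) (j : ℕ) : MemLp (dirichlet m j) p (haar m) :=
  .of_bound (measurable_dirichlet j).aestronglyMeasurable j (.of_forall (norm_dirichlet_le j))

lemma memLp_quadKernel (c : ℕ → ℝ) (J : ℕ) (y : G m) (p : ℝ≥0∞) :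
    MemLp (fun x => quadKernel m c J x y) p (haar m) :=
  memLp_finsetSum _ fun j _ => ((memLp_dirichlet p j).mul_const _).const_mul _

lemma memLp_quadBlock (c : ℕ → ℝ) (t N : ℕ) (y : G m) (p : ℝ≥0∞) :
    MemLp (fun x => quadBlock m c t N x y) p (haar m) :=
  memLp_finsetSum _ fun l _ => ((memLp_dirichlet p l).mul_const _).const_mul _

lemma quadBlock_add_of_mem_I (c : ℕ → ℝ) {t : ℕ} (N : ℕ) {e : G m} (he : e ∈ I m t 0) (x y : G m) :
    quadBlock m c t N (e + x) y = quadBlock m c t N x y :=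
  Finset.sum_congr rfl fun l hl => by
    rw [dirichlet_add_of_mem_I (Finset.mem_range.1 hl).le he]

variable (hm : ∀ k, 2 ≤ m k)
include hm

lemma quadKernel_mul_M (c : ℕ → ℝ) (Q : ℕ) {s : ℕ} {x : G m} (hxs : x s ≠ 0) (y : G m) :
    quadKernel m c (Q * M m (s + 1)) x y
      = ∑ N ∈ Finset.range Q, quadBlock m c (s + 1) N x y * psi m (N * M m (s + 1)) x := by
  rw [quadKernel, sum_range_mul_eq]
  refine Finset.sum_congr rfl fun N _ => ?_
  rw [quadBlock, Finset.sum_mul]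
  refine Finset.sum_congr rfl fun l hl => ?_
  rw [dirichlet_mul_M_add hm N (s + 1) (Finset.mem_range.1 hl).le,
    dirichlet_mul_M_eq_zero hm N hxs]
  ring

lemma setIntegral_annulus_norm_sq_quadKernel (c : ℕ → ℝ) (Q s : ℕ) (y : G m) :
    ∫ x in annulus m s, ‖quadKernel m c (Q * M m (s + 1)) x y‖ ^ 2 ∂haar m
      = ∑ N ∈ Finset.range Q, ∫ x in annulus m s, ‖quadBlock m c (s + 1) N x y‖ ^ 2 ∂haar m := by
  let b (N : ℕ) : G m → ℂ := (annulus m s).indicator fun x => quadBlock m c (s + 1) N x y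
  have bessel := integral_norm_sq_sum_mul_psi hm (s + 1) Q (b := b)
    (fun N _ => (memLp_quadBlock c (s + 1) N y 2).indicator (measurableSet_annulus s))
    (fun N _ e he x => by
      classical
      simp only [b, Set.indicator_apply, add_mem_annulus_iff he, quadBlock_add_of_mem_I c N he])
  have expand (x : G m) : ‖∑ N ∈ Finset.range Q, b N x * psi m (N * M m (s + 1)) x‖ ^ 2
      = (annulus m s).indicator (fun x => ‖quadKernel m c (Q * M m (s + 1)) x y‖ ^ 2) x := by
    by_cases hx : x ∈ annulus m s
    · simp only [b, Set.indicator_of_mem hx, quadKernel_mul_M hm c Q (mem_annulus.1 hx).2]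
    · simp [b, Set.indicator_of_notMem hx]
  have norm_sq_b (N : ℕ) (x : G m) : ‖b N x‖ ^ 2
      = (annulus m s).indicator (fun x => ‖quadBlock m c (s + 1) N x y‖ ^ 2) x := by
    by_cases hx : x ∈ annulus m s
    · simp only [b, Set.indicator_of_mem hx]
    · simp [b, Set.indicator_of_notMem hx]
  simpa only [expand, norm_sq_b, integral_indicator (measurableSet_annulus s)] using bessel

variable {B : ℕ} (hB : ∀ k, m k ≤ B) {c : ℕ → ℝ} {W : ℝ} {K : ℕ} (hc : ∀ j < M m K, |c j| ≤ W)
include hB hc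

lemma norm_quadBlock_le {s N : ℕ} (hs : s ≤ K) (hN : (N + 1) * M m (s + 1) ≤ M m K)
    {x y : G m} (hx : x ∈ annulus m s) (hy : y ∈ I m s 0) :
    ‖quadBlock m c (s + 1) N x y‖
      ≤ W * M m (s + 1) * ((B + 1) * M m s * dirichletMajorant m B s K y) := by
  rw [mem_annulus] at hx
  rw [Nat.succ_mul] at hN
  have majorant_x {l : ℕ} (hl : l ≤ M m (s + 1)) : ‖dirichlet m l x‖ ≤ (B + 1) * M m s :=
    delta_of_mem hx.1 ▸ (norm_dirichlet_le_dirichletMajorant hm hB s.le_succ hl hx.1).trans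
      (dirichletMajorant_le_of_ne_zero B _ hx.2)
  calc _ ≤ ∑ l ∈ Finset.range (M m (s + 1)), |c (N * M m (s + 1) + l)| *
          ((B + 1) * M m s * dirichletMajorant m B s K y) := by
        refine norm_sum_ofReal_mul_le _ _ fun l hl => ?_
        have hl := Finset.mem_range.1 hl
        exact norm_mul_le_of_le (majorant_x hl.le)
          (norm_dirichlet_le_dirichletMajorant hm hB hs (by omega) hy)
    _ ≤ ∑ l ∈ Finset.range (M m (s + 1)), W *
          ((B + 1) * M m s * dirichletMajorant m B s K y) := by
        have := dirichletMajorant_nonneg B s K y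
        gcongr with l hl
        have := Finset.mem_range.1 hl
        exact hc _ (by omega)
    _ = _ := by
        rw [Finset.sum_const, Finset.card_range, nsmul_eq_mul]
        ring

/-- Orthogonality of the `Q` blocks improves the trivial bound by the factor `Q ^ (-1/2)`. -/
lemma setIntegral_annulus_norm_quadKernel_le {s Q : ℕ} (hs : s ≤ K)
    (hQ : Q * M m (s + 1) = M m K) {y : G m} (hy : y ∈ I m s 0) :
    ∫ x in annulus m s, ‖quadKernel m c (M m K) x y‖ ∂haar m
      ≤ (B + 1) * (W * M m (s + 1)) * √Q * dirichletMajorant m B s K y := by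
  set L := dirichletMajorant m B s K y
  set R := W * M m (s + 1) * ((B + 1) * M m s * L) with hR
  have hL : 0 ≤ L := dirichletMajorant_nonneg B s K y
  have hW : 0 ≤ W := (abs_nonneg _).trans (hc 0 (M_pos K))
  have hM : (0 : ℝ) < M m s := by exact_mod_cast M_pos s
  have block {N : ℕ} (hN : N < Q) :
      ∫ x in annulus m s, ‖quadBlock m c (s + 1) N x y‖ ^ 2 ∂haar m ≤ R ^ 2 * (M m s : ℝ)⁻¹ := by
    refine setIntegral_annulus_le (sq_nonneg R) fun x hx => ?_
    rw [abs_pow, abs_norm]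
    gcongr
    exact norm_quadBlock_le hm hB hc hs (hQ ▸ Nat.mul_le_mul_right _ hN) hx hy
  calc _ ≤ √((haar m).real (annulus m s) *
          ∫ x in annulus m s, ‖quadKernel m c (M m K) x y‖ ^ 2 ∂haar m) := by
        simpa using integral_norm_le_sqrt ((memLp_quadKernel c (M m K) y 2).restrict (annulus m s))
    _ ≤ √((M m s : ℝ)⁻¹ * (Q * (R ^ 2 * (M m s : ℝ)⁻¹))) := by
        rw [← hQ, setIntegral_annulus_norm_sq_quadKernel hm]
        gcongr
        · exact haar_real_annulus_le s
        · exact (Finset.sum_le_sum fun N hN => block (Finset.mem_range.1 hN)).trans_eq (by simp)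
    _ = √(Q * (R / M m s) ^ 2) := by
        congr 1
        field_simp
    _ = √Q * (R / M m s) := by rw [Real.sqrt_mul Q.cast_nonneg, Real.sqrt_sq (by positivity)]
    _ = _ := by
        rw [hR]
        field_simp

end QuadBlocks

section QuadConst

lemma inv_sqrt_two_lt_one : (√2)⁻¹ < (1 : ℝ) :=
  inv_lt_one_of_one_lt₀ (Real.lt_sqrt_of_sq_lt (by norm_num))

lemma summable_add_two_mul_inv_sqrt_two_pow :
    Summable fun d : ℕ => ((d : ℝ) + 2) * (√2)⁻¹ ^ d := by
  have h : ‖(√2)⁻¹‖ < (1 : ℝ) := by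
    rw [Real.norm_of_nonneg (by positivity)]
    exact inv_sqrt_two_lt_one
  simpa only [add_mul, pow_one] using (summable_pow_mul_geometric_of_norm_lt_one 1 h).add
    ((summable_geometric_of_norm_lt_one h).mul_left 2)

/-- The constant in the bound for the `L^1` norms of quadratic kernels with bounded weights. -/
noncomputable def quadConst (B : ℕ) : ℝ :=
  2 * (B + 1) ^ 2 * ∑' d : ℕ, ((d : ℝ) + 2) * (√2)⁻¹ ^ d + 1

lemma quadConst_nonneg (B : ℕ) : 0 ≤ quadConst B := by
  have : 0 ≤ ∑' d : ℕ, ((d : ℝ) + 2) * (√2)⁻¹ ^ d := tsum_nonneg fun d => by positivity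
  unfold quadConst
  positivity

variable {m : ℕ → ℕ} (hm : ∀ k, 2 ≤ m k)
include hm

lemma two_pow_mul_M_le (s d : ℕ) : 2 ^ d * M m s ≤ M m (s + d) := by
  induction d with
  | zero => simp
  | succ d ih =>
    rw [← add_assoc, M, pow_succ, mul_comm (2 ^ d), mul_assoc]
    exact Nat.mul_le_mul (hm _) ih

variable [∀ k, NeZero (m k)]

lemma M_mul_sqrt_le {s d Q : ℕ} (hQ : Q * M m s = M m (s + d)) :
    (M m s : ℝ) * √Q ≤ M m (s + d) * (√2)⁻¹ ^ d := by
  have hQ2 : (2 : ℝ) ^ d ≤ Q := by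
    exact_mod_cast Nat.le_of_mul_le_mul_right ((two_pow_mul_M_le hm s d).trans_eq hQ.symm) (M_pos s)
  have sqrt_le : (√2) ^ d ≤ √Q :=
    Real.le_sqrt_of_sq_le (by rwa [← pow_mul, mul_comm, pow_mul, Real.sq_sqrt zero_le_two])
  rw [inv_pow, ← div_eq_mul_inv, le_div_iff₀ (by positivity)]
  calc (M m s : ℝ) * √Q * √2 ^ d ≤ M m s * √Q * √Q := by gcongr
    _ = M m (s + d) := by
      rw [mul_assoc, Real.mul_self_sqrt Q.cast_nonneg, ← hQ, Nat.cast_mul, mul_comm]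

lemma setIntegral_annulus_norm_quadKernel_mul_le {B : ℕ} (hB : ∀ k, m k ≤ B) {c : ℕ → ℝ} {W : ℝ}
    {K : ℕ} (hc : ∀ j < M m K, |c j| ≤ W) {s : ℕ} (hs : s < K) {y : G m} (hy : y ∈ I m s 0) :
    ∫ x in annulus m s, ‖quadKernel m c (M m K) x y‖ ∂haar m
      ≤ (B + 1) * (W * M m K) * (√2)⁻¹ ^ (K - 1 - s) * dirichletMajorant m B s K y := by
  have hW : 0 ≤ W := (abs_nonneg _).trans (hc 0 (M_pos K))
  obtain ⟨Q, hQ⟩ := M_dvd_M (m := m) (Nat.succ_le_of_lt hs)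
  rw [mul_comm] at hQ
  have sqrt_le := M_mul_sqrt_le hm (s := s + 1) (d := K - 1 - s) (Q := Q)
  rw [show s + 1 + (K - 1 - s) = K by omega] at sqrt_le
  have majorant_nonneg := dirichletMajorant_nonneg (m := m) B s K y
  calc _ ≤ (B + 1) * (W * M m (s + 1)) * √Q * dirichletMajorant m B s K y :=
        setIntegral_annulus_norm_quadKernel_le hm hB hc hs.le hQ.symm hy
    _ = (B + 1) * W * (M m (s + 1) * √Q) * dirichletMajorant m B s K y := by ring
    _ ≤ (B + 1) * W * (M m K * (√2)⁻¹ ^ (K - 1 - s)) * dirichletMajorant m B s K y := by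
        gcongr _ * ?_ * _
        exact sqrt_le hQ.symm
    _ = _ := by ring

lemma integral_norm_quadKernel_le {B : ℕ} (hB : ∀ k, m k ≤ B) {c : ℕ → ℝ} {W : ℝ} {K : ℕ}
    (hc : ∀ j < M m K, |c j| ≤ W) :
    ∫ z, ‖quadKernel m c (M m K) z.1 z.2‖ ∂haar2 m ≤ quadConst B * (W * M m K) := by
  have hW : 0 ≤ W := (abs_nonneg _).trans (hc 0 (M_pos K))
  have weights : ∑ j ∈ Finset.range (M m K), |c j| ≤ W * M m K :=
    (Finset.sum_le_card_nsmul _ _ W fun j hj => hc j (Finset.mem_range.1 hj)).trans_eq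
      (by rw [Finset.card_range, nsmul_eq_mul, mul_comm])
  have majorants {s : ℕ} (hs : s ∈ Finset.range K) :
      (1 + B * (K - s : ℕ) : ℝ) ≤ (B + 1) * ((K - 1 - s : ℕ) + 2) := by
    rw [show K - s = K - 1 - s + 1 by have := Finset.mem_range.1 hs; omega]
    push_cast
    linear_combination (B.cast_nonneg : (0 : ℝ) ≤ B) +
      ((K - 1 - s).cast_nonneg : (0 : ℝ) ≤ (K - 1 - s : ℕ))
  calc _ ≤ 2 * ∑ s ∈ Finset.range K,
          (B + 1) * (W * M m K) * (√2)⁻¹ ^ (K - 1 - s) * (1 + B * (K - s : ℕ)) + W * M m K :=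
        (integral_norm_quadKernel_le_of_forall_annulus c (Nat.le_succ _) B
          (fun s => by positivity)
          fun s hs y hy => setIntegral_annulus_norm_quadKernel_mul_le hm hB hc hs hy).trans
          (add_le_add_right weights _)
    _ ≤ 2 * ∑ s ∈ Finset.range K, (B + 1) * (W * M m K) * (√2)⁻¹ ^ (K - 1 - s) *
          ((B + 1) * ((K - 1 - s : ℕ) + 2)) + W * M m K := by
        gcongr with s hs
        exact majorants hs
    _ = 2 * (B + 1) ^ 2 * (W * M m K) *
          ∑ d ∈ Finset.range K, ((d : ℝ) + 2) * (√2)⁻¹ ^ d + W * M m K := by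
        rw [← Finset.sum_range_reflect (fun d : ℕ => ((d : ℝ) + 2) * (√2)⁻¹ ^ d),
          Finset.mul_sum, Finset.mul_sum]
        exact congrArg (· + _) (Finset.sum_congr rfl fun s _ => by ring)
    _ ≤ 2 * (B + 1) ^ 2 * (W * M m K) * ∑' d : ℕ, ((d : ℝ) + 2) * (√2)⁻¹ ^ d + W * M m K := by
        gcongr
        exact summable_add_two_mul_inv_sqrt_two_pow.sum_le_tsum _ fun d _ => by positivity
    _ = quadConst B * (W * M m K) := by
        rw [quadConst]
        ring

end QuadConst

section Minkowski

variable {X Y : Type*} [MeasurableSpace X] [MeasurableSpace Y]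

lemma lintegral_rpow_le {ρ : Measure Y} {h : Y → ℝ≥0∞} (hh : AEMeasurable h ρ) {q : ℝ}
    (hq : 1 ≤ q) : (∫⁻ y, h y ∂ρ) ^ q ≤ (∫⁻ y, h y ^ q ∂ρ) * ρ Set.univ ^ (q - 1) := by
  have hq0 : 0 < q := zero_lt_one.trans_le hq
  have holder := eLpNorm'_le_eLpNorm'_mul_rpow_measure_univ zero_lt_one hq hh.aestronglyMeasurable
  simp only [eLpNorm', enorm_eq_self, ENNReal.rpow_one, div_one] at holder
  calc _ ≤ ((∫⁻ y, h y ^ q ∂ρ) ^ (1 / q) * ρ Set.univ ^ (1 - 1 / q)) ^ q := by gcongr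
    _ = _ := by
      rw [ENNReal.mul_rpow_of_nonneg _ _ hq0.le, ← ENNReal.rpow_mul, ← ENNReal.rpow_mul,
        one_div_mul_cancel hq0.ne', ENNReal.rpow_one, sub_mul, one_mul, one_div_mul_cancel hq0.ne']

variable {μ : Measure X} {ρ : Measure Y} [SFinite μ] [SFinite ρ] {F : X → Y → ℝ≥0∞}

lemma eLpNorm_top_lintegral_le (hF : Measurable (Function.uncurry F)) {C : ℝ≥0∞}
    (h : ∀ᵐ y ∂ρ, eLpNorm (fun x => F x y) ∞ μ ≤ C) :
    eLpNorm (fun x => ∫⁻ y, F x y ∂ρ) ∞ μ ≤ ρ Set.univ * C := by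
  have pointwise : ∀ᵐ y ∂ρ, ∀ᵐ x ∂μ, F x y ≤ C := by
    filter_upwards [h] with y hy
    filter_upwards [enorm_ae_le_eLpNormEssSup (fun x => F x y) μ] with x hx
    exact hx.trans (eLpNorm_exponent_top.symm.trans_le hy)
  rw [eLpNorm_exponent_top]
  refine eLpNormEssSup_le_of_ae_enorm_bound ?_
  have measurableSet_le_C : MeasurableSet {z : Y × X | F z.2 z.1 ≤ C} :=
    measurableSet_le (hF.comp measurable_swap) measurable_const
  filter_upwards [(Measure.ae_ae_comm measurableSet_le_C).1 pointwise] with x hx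
  calc ‖∫⁻ y, F x y ∂ρ‖ₑ ≤ ∫⁻ _, C ∂ρ := lintegral_mono_ae hx
    _ = ρ Set.univ * C := by rw [lintegral_const, mul_comm]

lemma eLpNorm_lintegral_le (hF : Measurable (Function.uncurry F)) {p : ℝ≥0∞} (hp : 1 ≤ p)
    {C : ℝ≥0∞} (h : ∀ᵐ y ∂ρ, eLpNorm (fun x => F x y) p μ ≤ C) :
    eLpNorm (fun x => ∫⁻ y, F x y ∂ρ) p μ ≤ ρ Set.univ * C := by
  rcases eq_or_ne p ∞ with rfl | hp_top
  · exact eLpNorm_top_lintegral_le hF h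
  have hp0 : p ≠ 0 := (zero_lt_one.trans_le hp).ne'
  have hq : 1 ≤ p.toReal := ENNReal.toReal_mono hp_top hp
  have hq0 : 0 < p.toReal := zero_lt_one.trans_le hq
  simp only [eLpNorm_eq_lintegral_rpow_enorm_toReal hp0 hp_top, enorm_eq_self, one_div,
    ENNReal.rpow_inv_le_iff hq0] at h ⊢
  calc ∫⁻ x, (∫⁻ y, F x y ∂ρ) ^ p.toReal ∂μ
      ≤ ∫⁻ x, (∫⁻ y, F x y ^ p.toReal ∂ρ) * ρ Set.univ ^ (p.toReal - 1) ∂μ :=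
        lintegral_mono fun x => lintegral_rpow_le (by fun_prop) hq
    _ = (∫⁻ x, ∫⁻ y, F x y ^ p.toReal ∂ρ ∂μ) * ρ Set.univ ^ (p.toReal - 1) :=
        lintegral_mul_const _ (Measurable.lintegral_prod_right' (hF.pow_const p.toReal))
    _ = (∫⁻ y, ∫⁻ x, F x y ^ p.toReal ∂μ ∂ρ) * ρ Set.univ ^ (p.toReal - 1) := by
        rw [lintegral_lintegral_swap (hF.pow_const p.toReal).aemeasurable]
    _ ≤ (∫⁻ _, C ^ p.toReal ∂ρ) * ρ Set.univ ^ (p.toReal - 1) := by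
        gcongr ?_ * _
        exact lintegral_mono_ae h
    _ = C ^ p.toReal * ρ Set.univ ^ (1 + (p.toReal - 1)) := by
        rw [lintegral_const, mul_assoc, ENNReal.rpow_add_of_nonneg _ _ zero_le_one
          (sub_nonneg.2 hq), ENNReal.rpow_one]
    _ = (ρ Set.univ * C) ^ p.toReal := by
        rw [add_sub_cancel, mul_comm, ENNReal.mul_rpow_of_nonneg _ _ hq0.le]

lemma eLpNorm_integral_mul_le {κ : Y → ℂ} (hκ : Measurable κ) {Φ : X → Y → ℂ}
    (hΦ : Measurable (Function.uncurry Φ)) {p : ℝ≥0∞} (hp : 1 ≤ p) {C : ℝ≥0∞}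
    (h : ∀ y, κ y ≠ 0 → eLpNorm (fun x => Φ x y) p μ ≤ C) :
    eLpNorm (fun x => ∫ y, Φ x y * κ y ∂ρ) p μ ≤ (∫⁻ y, ‖κ y‖ₑ ∂ρ) * C := by
  have norm_le (x : X) : ‖∫ y, Φ x y * κ y ∂ρ‖ₑ
      ≤ ‖∫⁻ y, ‖Φ x y‖ₑ ∂ρ.withDensity (‖κ ·‖ₑ)‖ₑ := by
    rw [enorm_eq_self, lintegral_withDensity_eq_lintegral_mul _ hκ.enorm (by fun_prop)]
    refine (enorm_integral_le_lintegral_enorm _).trans_eq (lintegral_congr fun y => ?_)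
    rw [enorm_mul, Pi.mul_apply, mul_comm]
  have slices : ∀ᵐ y ∂ρ.withDensity (‖κ ·‖ₑ), eLpNorm (fun x => ‖Φ x y‖ₑ) p μ ≤ C := by
    simp only [eLpNorm_enorm]
    exact (ae_withDensity_iff hκ.enorm).2 (Filter.Eventually.of_forall fun y hy =>
      h y (enorm_ne_zero.1 hy))
  calc _ ≤ (ρ.withDensity (‖κ ·‖ₑ)) Set.univ * C :=
        (eLpNorm_mono_enorm norm_le).trans (eLpNorm_lintegral_le hΦ.enorm hp slices)
    _ = _ := by rw [withDensity_apply _ .univ, setLIntegral_univ]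

end Minkowski

section Convolution

variable {m : ℕ → ℕ} [∀ k, NeZero (m k)] {f g : G m × G m → ℂ}

@[fun_prop]
lemma measurable_partialSum (a b : ℕ) : Measurable (partialSum m f a b) := by
  unfold partialSum
  fun_prop

lemma integrable_partialSum (a b : ℕ) : Integrable (partialSum m f a b) (haar2 m) :=
  .of_bound (by fun_prop) (∑ k₁ ∈ Finset.range a, ∑ k₂ ∈ Finset.range b, ‖fourierCoeff m f k₁ k₂‖)
    (Filter.Eventually.of_forall fun z => norm_sum_le_of_le _ fun k₁ _ =>
      norm_sum_le_of_le _ fun k₂ _ => by simp [norm_psi])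

lemma integrable_mul_conj_psi (hf : Integrable f (haar2 m)) (a b : ℕ) :
    Integrable (fun z => f z * (starRingEnd ℂ) (psi m a z.1) * (starRingEnd ℂ) (psi m b z.2))
      (haar2 m) := by
  simp only [mul_assoc]
  exact hf.mul_bdd (c := 1) (Measurable.aestronglyMeasurable (by fun_prop))
    (Filter.Eventually.of_forall fun z => by simp [norm_psi])

lemma integrable_comp_add_mul_conj_dirichlet (hf : Integrable f (haar2 m)) (j : ℕ)
    (z : G m × G m) :
    Integrable (fun w => f (z + w) * (starRingEnd ℂ) (dirichlet m j w.1 * dirichlet m j w.2))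
      (haar2 m) :=
  (hf.comp_add_left z).mul_bdd (c := (j : ℝ) * j) (by fun_prop) <|
    Filter.Eventually.of_forall fun w => by
      rw [RCLike.norm_conj]
      exact norm_mul_le_of_le (norm_dirichlet_le _ _) (norm_dirichlet_le _ _)

lemma fourierCoeff_mul_psi (a b : ℕ) (z : G m × G m) :
    fourierCoeff m f a b * psi m a z.1 * psi m b z.2
      = ∫ w, f (z + w) * (starRingEnd ℂ) (psi m a w.1 * psi m b w.2) ∂haar2 m := by
  rw [fourierCoeff, ← integral_add_left_eq_self _ z, mul_assoc, ← integral_mul_const]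
  refine integral_congr_ae (Filter.Eventually.of_forall fun w => ?_)
  simp only [Prod.fst_add, Prod.snd_add, psi_add, map_mul]
  linear_combination (f (z + w) * (starRingEnd ℂ) (psi m a w.1) * (starRingEnd ℂ) (psi m b w.2))
    * (psi m a z.1 * (starRingEnd ℂ) (psi m a z.1) * psi_mul_conj_psi b z.2 +
      psi_mul_conj_psi a z.1)

lemma partialSum_eq_integral (hf : Integrable f (haar2 m)) (j : ℕ) (z : G m × G m) :
    partialSum m f j j z
      = ∫ w, f (z + w) * (starRingEnd ℂ) (dirichlet m j w.1 * dirichlet m j w.2) ∂haar2 m := by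
  have integrable_term (a b : ℕ) : Integrable (fun w => f (z + w) *
      (starRingEnd ℂ) (psi m a w.1 * psi m b w.2)) (haar2 m) :=
    (hf.comp_add_left z).mul_bdd (c := 1) (by fun_prop)
      (Filter.Eventually.of_forall fun w => by simp [norm_psi])
  simp only [partialSum, fourierCoeff_mul_psi, dirichlet, Finset.sum_mul_sum]
  simp only [map_sum, Finset.mul_sum]
  rw [integral_finsetSum _ fun a _ => integrable_finsetSum _ fun b _ => integrable_term a b]
  exact Finset.sum_congr rfl fun a _ => (integral_finsetSum _ fun b _ => integrable_term a b).symm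

lemma sum_mul_partialSum (hf : Integrable f (haar2 m)) (c : ℕ → ℝ) (J : ℕ) (z : G m × G m) :
    ∑ j ∈ Finset.range J, (c j : ℂ) * partialSum m f j j z
      = ∫ w, f (z + w) * (starRingEnd ℂ) (quadKernel m c J w.1 w.2) ∂haar2 m := by
  simp only [partialSum_eq_integral hf, ← integral_const_mul]
  rw [← integral_finsetSum _ fun j _ =>
    (integrable_comp_add_mul_conj_dirichlet hf j z).const_mul (c j : ℂ)]
  refine integral_congr_ae (Filter.Eventually.of_forall fun w => ?_)
  simp only [quadKernel, map_sum, Finset.mul_sum]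
  refine Finset.sum_congr rfl fun j _ => ?_
  rw [map_mul _ (c j : ℂ), Complex.conj_ofReal, mul_left_comm]

lemma eLpNorm_sum_mul_partialSum_le (hfm : Measurable f) (hf : Integrable f (haar2 m)) {p : ℝ≥0∞}
    (hp : 1 ≤ p) (c : ℕ → ℝ) (J : ℕ) :
    eLpNorm (fun z => ∑ j ∈ Finset.range J, (c j : ℂ) * partialSum m f j j z) p (haar2 m)
      ≤ ENNReal.ofReal (∫ z, ‖quadKernel m c J z.1 z.2‖ ∂haar2 m) * eLpNorm f p (haar2 m) := by
  have := measurable_quadKernel (m := m) c J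
  simp only [sum_mul_partialSum hf]
  refine (eLpNorm_integral_mul_le (Φ := fun z w => f (z + w)) (by fun_prop)
    (hfm.comp measurable_add) hp fun w _ => (eLpNorm_comp_measurePreserving
      hfm.aestronglyMeasurable (measurePreserving_add_right (haar2 m) w)).le).trans_eq ?_
  rw [ofReal_integral_norm_eq_lintegral_enorm (integrable_quadKernel c J)]
  simp only [← ofReal_norm, RCLike.norm_conj]

lemma eLpNorm_comp_add_sub_self_le (hf : Measurable f) {p : ℝ≥0∞} (hp : 1 ≤ p) {r : ℕ} {u v : G m}
    (hu : u ∈ I m r 0) (hv : v ∈ I m r 0) :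
    eLpNorm (fun z => f (z + (u, v)) - f z) p (haar2 m) ≤ omega1 m f r p + omega2 m f r p := by
  set f₁ : G m × G m → ℂ := fun z => f (z.1 + u, z.2) - f z with f₁_def
  set f₂ : G m × G m → ℂ := fun z => f (z.1, z.2 + v) - f z with f₂_def
  have hf₁ : Measurable f₁ := (hf.comp (by fun_prop)).sub hf
  have hf₂ : Measurable f₂ := (hf.comp (by fun_prop)).sub hf
  have translation := measurePreserving_add_right (haar2 m) ((0 : G m), v)
  have decomposition : (fun z => f (z + (u, v)) - f z) = f₁ ∘ (· + (0, v)) + f₂ := by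
    ext ⟨x, y⟩
    simp [f₁_def, f₂_def]
  calc _ ≤ eLpNorm (f₁ ∘ (· + (0, v))) p (haar2 m) + eLpNorm f₂ p (haar2 m) := by
        rw [decomposition]
        exact eLpNorm_add_le (hf₁.comp translation.measurable).aestronglyMeasurable
          hf₂.aestronglyMeasurable hp
    _ = eLpNorm f₁ p (haar2 m) + eLpNorm f₂ p (haar2 m) := by
        rw [eLpNorm_comp_measurePreserving hf₁.aestronglyMeasurable translation]
    _ ≤ _ := add_le_add
        (le_iSup₂ (f := fun u (_ : u ∈ I m r 0) =>
          eLpNorm (fun z : G m × G m => f (z.1 + u, z.2) - f z) p (haar2 m)) u hu)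
        (le_iSup₂ (f := fun v (_ : v ∈ I m r 0) =>
          eLpNorm (fun z : G m × G m => f (z.1, z.2 + v) - f z) p (haar2 m)) v hv)

lemma fourierCoeff_sub (hf : Integrable f (haar2 m)) (hg : Integrable g (haar2 m)) (a b : ℕ) :
    fourierCoeff m (fun z => f z - g z) a b = fourierCoeff m f a b - fourierCoeff m g a b := by
  simp only [fourierCoeff, sub_mul]
  exact integral_sub (integrable_mul_conj_psi hf a b) (integrable_mul_conj_psi hg a b)

lemma partialSum_sub (hf : Integrable f (haar2 m)) (hg : Integrable g (haar2 m)) (a b : ℕ)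
    (z : G m × G m) :
    partialSum m (fun z => f z - g z) a b z = partialSum m f a b z - partialSum m g a b z := by
  simp only [partialSum, fourierCoeff_sub hf hg, sub_mul, Finset.sum_sub_distrib]

lemma integrable_delta_mul_delta (r : ℕ) :
    Integrable (fun w : G m × G m => (delta m r w.1 : ℂ) * delta m r w.2) (haar2 m) :=
  (integrable_delta r).ofReal.mul_prod (integrable_delta r).ofReal

lemma integral_delta_mul_delta (r : ℕ) :
    ∫ w, (delta m r w.1 : ℂ) * delta m r w.2 ∂haar2 m = 1 := by
  rw [haar2, integral_prod_mul (fun x => (delta m r x : ℂ)) (fun y => (delta m r y : ℂ)),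
    integral_complex_ofReal, integral_delta, Complex.ofReal_one, one_mul]

lemma lintegral_enorm_delta_mul_delta (r : ℕ) :
    ∫⁻ w : G m × G m, ‖(delta m r w.1 : ℂ) * delta m r w.2‖ₑ ∂haar2 m = 1 := by
  have norm_eq (w : G m × G m) : ((‖(delta m r w.1 : ℂ) * delta m r w.2‖ : ℝ) : ℂ)
      = delta m r w.1 * delta m r w.2 := by
    rw [norm_mul, Complex.norm_of_nonneg (delta_nonneg r _),
      Complex.norm_of_nonneg (delta_nonneg r _), Complex.ofReal_mul]
  rw [← ofReal_integral_norm_eq_lintegral_enorm (integrable_delta_mul_delta r),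
    ENNReal.ofReal_eq_one, ← Complex.ofReal_inj, ← integral_complex_ofReal, Complex.ofReal_one,
    ← integral_delta_mul_delta (m := m) r]
  simp only [norm_eq]

variable (hm : ∀ k, 2 ≤ m k)
include hm

lemma partialSum_M_sub_self_eq_integral (hf : Integrable f (haar2 m)) (r : ℕ) (z : G m × G m) :
    partialSum m f (M m r) (M m r) z - f z
      = ∫ w, (f (z + w) - f z) * (delta m r w.1 * delta m r w.2) ∂haar2 m := by
  have integrable_average := integrable_comp_add_mul_conj_dirichlet hf (M m r) z
  have average := partialSum_eq_integral hf (M m r) z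
  simp only [dirichlet_M hm, map_mul, Complex.conj_ofReal] at integrable_average average
  simp only [sub_mul]
  rw [integral_sub integrable_average ((integrable_delta_mul_delta r).const_mul _),
    integral_const_mul, integral_delta_mul_delta, mul_one, average]

lemma eLpNorm_sub_partialSum_M_le (hfm : Measurable f) (hf : Integrable f (haar2 m)) {p : ℝ≥0∞}
    (hp : 1 ≤ p) (r : ℕ) :
    eLpNorm (fun z => f z - partialSum m f (M m r) (M m r) z) p (haar2 m)
      ≤ omega1 m f r p + omega2 m f r p := by
  have near : ∀ w : G m × G m, (delta m r w.1 : ℂ) * delta m r w.2 ≠ 0 →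
      eLpNorm (fun z => f (z + w) - f z) p (haar2 m) ≤ omega1 m f r p + omega2 m f r p := by
    rintro ⟨u, v⟩ huv
    simp only [mul_ne_zero_iff, Complex.ofReal_ne_zero] at huv
    exact eLpNorm_comp_add_sub_self_le hfm hp (not_imp_comm.1 delta_of_notMem huv.1)
      (not_imp_comm.1 delta_of_notMem huv.2)
  calc _ = eLpNorm (fun z => partialSum m f (M m r) (M m r) z - f z) p (haar2 m) :=
        eLpNorm_sub_comm _ _ _ _
    _ ≤ (∫⁻ w : G m × G m, ‖(delta m r w.1 : ℂ) * delta m r w.2‖ₑ ∂haar2 m) *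
          (omega1 m f r p + omega2 m f r p) := by
        simp only [partialSum_M_sub_self_eq_integral hm hf]
        exact eLpNorm_integral_mul_le (Φ := fun z w => f (z + w) - f z) (by fun_prop)
          ((hfm.comp measurable_add).sub (hfm.comp measurable_fst)) hp near
    _ = _ := by rw [lintegral_enorm_delta_mul_delta, one_mul]

lemma integral_psi_mul_conj_psi (a b : ℕ) :
    ∫ x, psi m a x * (starRingEnd ℂ) (psi m b x) ∂haar m = if a = b then 1 else 0 := by
  split_ifs with h
  · simp [h, psi_mul_conj_psi]
  · simpa using integral_mul_psi_mul_conj_psi hm (s := 0) h (one_dvd a) (one_dvd b)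
      (g := fun _ => 1) (by simp)

lemma fourierCoeff_psi_mul_psi (k₁ k₂ a b : ℕ) :
    fourierCoeff m (fun z => psi m k₁ z.1 * psi m k₂ z.2) a b
      = if k₁ = a ∧ k₂ = b then 1 else 0 := by
  calc _ = ∫ z : G m × G m, psi m k₁ z.1 * (starRingEnd ℂ) (psi m a z.1) *
          (psi m k₂ z.2 * (starRingEnd ℂ) (psi m b z.2)) ∂haar2 m :=
        integral_congr_ae (Filter.Eventually.of_forall fun z => by ring)
    _ = (if k₁ = a then 1 else 0) * if k₂ = b then 1 else 0 := by
        rw [haar2, integral_prod_mul (fun x => psi m k₁ x * (starRingEnd ℂ) (psi m a x))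
          (fun y => psi m k₂ y * (starRingEnd ℂ) (psi m b y)), integral_psi_mul_conj_psi hm,
          integral_psi_mul_conj_psi hm]
    _ = _ := by rw [ite_and, ite_mul, one_mul, zero_mul]

lemma fourierCoeff_partialSum (N₁ N₂ a b : ℕ) :
    fourierCoeff m (partialSum m f N₁ N₂) a b
      = if a < N₁ ∧ b < N₂ then fourierCoeff m f a b else 0 := by
  have integrable_term (k₁ k₂ : ℕ) : Integrable (fun z : G m × G m => fourierCoeff m f k₁ k₂ *
      (psi m k₁ z.1 * psi m k₂ z.2 * (starRingEnd ℂ) (psi m a z.1) *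
        (starRingEnd ℂ) (psi m b z.2))) (haar2 m) :=
    (integrable_mul_conj_psi (.of_bound (by fun_prop) 1
      (Filter.Eventually.of_forall fun z => by simp [norm_psi])) a b).const_mul _
  calc _ = ∫ z, ∑ k₁ ∈ Finset.range N₁, ∑ k₂ ∈ Finset.range N₂, fourierCoeff m f k₁ k₂ *
          (psi m k₁ z.1 * psi m k₂ z.2 * (starRingEnd ℂ) (psi m a z.1) *
            (starRingEnd ℂ) (psi m b z.2)) ∂haar2 m := by
        simp only [fourierCoeff.eq_1 m (partialSum m f N₁ N₂), partialSum, Finset.sum_mul,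
          mul_assoc]
    _ = ∑ k₁ ∈ Finset.range N₁, ∑ k₂ ∈ Finset.range N₂, fourierCoeff m f k₁ k₂ *
          fourierCoeff m (fun z => psi m k₁ z.1 * psi m k₂ z.2) a b := by
        rw [integral_finsetSum _ fun k₁ _ => integrable_finsetSum _ fun k₂ _ =>
          integrable_term k₁ k₂]
        simp only [integral_finsetSum _ fun k₂ _ => integrable_term _ k₂, integral_const_mul]
        rfl
    _ = _ := by
        simp only [fourierCoeff_psi_mul_psi hm, ite_and]
        split_ifs <;> simp [*]

lemma partialSum_partialSum {N₁ N₂ j₁ j₂ : ℕ} (h₁ : N₁ ≤ j₁) (h₂ : N₂ ≤ j₂) (z : G m × G m) :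
    partialSum m (partialSum m f N₁ N₂) j₁ j₂ z = partialSum m f N₁ N₂ z := by
  have filter_lt {N j : ℕ} (h : N ≤ j) : (Finset.range j).filter (· < N) = Finset.range N := by
    ext
    simp only [Finset.mem_filter, Finset.mem_range]
    omega
  rw [partialSum, partialSum, ← filter_lt h₁, ← filter_lt h₂, Finset.sum_filter]
  refine Finset.sum_congr rfl fun a _ => ?_
  rw [Finset.sum_filter]
  split_ifs with ha
  all_goals simp [fourierCoeff_partialSum hm, ha]

lemma partialSum_sub_partialSum_sub_self (hf : Integrable f (haar2 m)) {N j : ℕ} (h : N ≤ j)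
    (z : G m × G m) :
    partialSum m (fun z => f z - partialSum m f N N z) j j z - (f z - partialSum m f N N z)
      = partialSum m f j j z - f z := by
  rw [partialSum_sub hf (integrable_partialSum N N), partialSum_partialSum hm h h]
  ring

end Convolution

section Weights

lemma natCast_le_two_mul_log {k n : ℕ} (h : 2 ^ k ≤ n) : (k : ℝ) ≤ 2 * Real.log n := by
  have log_le : k * Real.log 2 ≤ Real.log n := by
    rw [← Real.log_pow]
    exact Real.log_le_log (by positivity) (by exact_mod_cast h)
  linarith [mul_le_mul_of_nonneg_left Real.log_two_gt_d9.le k.cast_nonneg]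

variable {α : ℝ} (h0 : 0 < α) (h1 : α < 1)
include h0 h1

lemma abs_cesaroA_neg_sub_one_sub_le {N n j : ℕ} (hN : 0 < N) (hn : N ≤ n) (hj : 2 * j ≤ N) :
    |cesaroA (-α - 1) (n - j)| ≤ 4 * (N : ℝ) ^ (-α - 1) := by
  have half_le : (N : ℝ) / 2 ≤ (n - j : ℕ) := by
    rw [div_le_iff₀ two_pos]
    exact_mod_cast (show N ≤ (n - j) * 2 by omega)
  calc |cesaroA (-α - 1) (n - j)| ≤ ((n - j : ℕ) : ℝ) ^ (-α - 1) :=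
        abs_cesaroA_neg_sub_one_le h0.le h1 (by omega)
    _ ≤ ((N : ℝ) / 2) ^ (-α - 1) :=
        Real.rpow_le_rpow_of_nonpos (by positivity) half_le (by linarith)
    _ = 2 ^ (α + 1) * (N : ℝ) ^ (-α - 1) := by
        rw [Real.div_rpow N.cast_nonneg zero_le_two, div_eq_mul_inv, mul_comm,
          ← Real.rpow_neg zero_le_two]
        ring_nf
    _ ≤ 2 ^ (2 : ℝ) * (N : ℝ) ^ (-α - 1) := by
        gcongr
        · exact one_le_two
        · linarith
    _ = 4 * (N : ℝ) ^ (-α - 1) := by norm_num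

lemma inv_cesaroA_neg_pred_le {B N n : ℕ} (hn : 1 ≤ n) (hB : n ≤ B * N) :
    (cesaroA (-α) (n - 1))⁻¹ ≤ B / (1 - α) * (N : ℝ) ^ α := by
  have : 0 < 1 - α := sub_pos.2 h1
  have hB1 : (1 : ℝ) ≤ B := by
    exact_mod_cast Nat.pos_of_mul_pos_right (hn.trans hB)
  calc (cesaroA (-α) (n - 1))⁻¹ ≤ (((n - 1 : ℕ) : ℝ) + 1) ^ α / (1 - α) :=
        inv_cesaroA_neg_le h0.le h1 (n - 1)
    _ ≤ (B * N : ℝ) ^ α / (1 - α) := by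
        rw [← Nat.cast_add_one, Nat.sub_add_cancel hn]
        gcongr
        exact_mod_cast hB
    _ ≤ B * (N : ℝ) ^ α / (1 - α) := by
        rw [Real.mul_rpow B.cast_nonneg N.cast_nonneg]
        gcongr
        exact Real.rpow_le_self_of_one_le hB1 h1.le
    _ = B / (1 - α) * (N : ℝ) ^ α := by ring

end Weights

section Approximation

lemma ofReal_mul_ofReal_mul_le {a b c d : ℝ} (ha : 0 ≤ a) (hc : 0 ≤ c) (h : a * b ≤ c * d)
    (X : ℝ≥0∞) :
    ENNReal.ofReal a * (ENNReal.ofReal b * X) ≤ ENNReal.ofReal c * (ENNReal.ofReal d * X) := by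
  rw [← mul_assoc, ← mul_assoc, ← ENNReal.ofReal_mul ha, ← ENNReal.ofReal_mul hc]
  gcongr

lemma eLpNorm_sum_mul_le {X : Type*} [MeasurableSpace X] {μ : Measure X} (S : Finset ℕ)
    (c : ℕ → ℝ) (h : X → ℂ) (p : ℝ≥0∞) :
    eLpNorm (fun z => ∑ j ∈ S, (c j : ℂ) * h z) p μ
      ≤ ENNReal.ofReal (∑ j ∈ S, |c j|) * eLpNorm h p μ := by
  have factor : (fun z => ∑ j ∈ S, (c j : ℂ) * h z) = (∑ j ∈ S, (c j : ℂ)) • h := by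
    ext z
    simp [Finset.sum_mul]
  rw [factor, eLpNorm_const_smul, ← ofReal_norm]
  gcongr
  exact norm_sum_le_of_le _ fun j _ => (Complex.norm_real (c j)).le

variable {m : ℕ → ℕ} {f : G m × G m → ℂ}

lemma sigma_sub_self {α : ℝ} (h1 : α < 1) {n : ℕ} (hn : 1 ≤ n) (z : G m × G m) :
    sigma m α n f z - f z = ((cesaroA (-α) (n - 1))⁻¹ : ℝ) *
      ∑ j ∈ Finset.Ico 1 (n + 1),
        (cesaroA (-α - 1) (n - j) : ℂ) * (partialSum m f j j z - f z) := by
  have hA : (cesaroA (-α) (n - 1) : ℂ) ≠ 0 := by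
    exact_mod_cast (cesaroA_neg_pos h1 (n - 1)).ne'
  have sum_weights : ∑ j ∈ Finset.Ico 1 (n + 1), (cesaroA (-α - 1) (n - j) : ℂ)
      = cesaroA (-α) (n - 1) := by
    rw [← sum_range_cesaroA_sub_one, Nat.sub_add_cancel hn, Finset.sum_Ico_eq_sum_range,
      Nat.add_sub_cancel, ← Finset.sum_range_reflect]
    push_cast
    refine Finset.sum_congr rfl fun j hj => ?_
    congr 2
    have := Finset.mem_range.1 hj
    omega
  simp only [mul_sub, Finset.sum_sub_distrib]
  rw [← Finset.sum_mul, sum_weights, sigma, ← Finset.Ico_add_one_right_eq_Icc, ← mul_assoc,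
    Complex.ofReal_inv, inv_mul_cancel₀ hA, one_mul]

variable [∀ k, NeZero (m k)]

lemma sum_Ico_one_M {E : Type*} [AddCommMonoid E] (g : ℕ → E) (K : ℕ) :
    ∑ j ∈ Finset.Ico 1 (M m K), g j
      = ∑ r ∈ Finset.range K, ∑ j ∈ Finset.Ico (M m r) (M m (r + 1)), g j := by
  induction K with
  | zero => simp [M]
  | succ K ih =>
    rw [Finset.sum_range_succ, ← ih,
      Finset.sum_Ico_consecutive _ (M_pos K) (M_le_M (Nat.le_succ K))]

variable (hm : ∀ k, 2 ≤ m k)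
include hm

-- On indices `j ≥ M_r` the operator `S_{j,j} - 1` is unchanged when `f` is replaced by
-- `f - S_{M_r,M_r} f`, whose norm is controlled by the moduli of continuity.
lemma eLpNorm_sum_Ico_mul_partialSum_sub_self_le (hfm : Measurable f)
    (hf : Integrable f (haar2 m)) {p : ℝ≥0∞} (hp : 1 ≤ p) (c : ℕ → ℝ) {r J : ℕ} (hJ : M m r ≤ J) :
    eLpNorm (fun z => ∑ j ∈ Finset.Ico (M m r) J, (c j : ℂ) * (partialSum m f j j z - f z))
        p (haar2 m)
      ≤ ENNReal.ofReal (∫ z, ‖quadKernel m c J z.1 z.2‖ ∂haar2 m +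
          ∫ z, ‖quadKernel m c (M m r) z.1 z.2‖ ∂haar2 m + ∑ j ∈ Finset.range J, |c j|) *
        (omega1 m f r p + omega2 m f r p) := by
  let g (z : G m × G m) : ℂ := f z - partialSum m f (M m r) (M m r) z
  have hgm : Measurable g := hfm.sub (measurable_partialSum _ _)
  have hg : Integrable g (haar2 m) := hf.sub (integrable_partialSum _ _)
  have sum_bound (L : ℕ) := eLpNorm_sum_mul_partialSum_le hgm hg hp c L
  have decomposition :
      (fun z => ∑ j ∈ Finset.Ico (M m r) J, (c j : ℂ) * (partialSum m f j j z - f z))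
        = ((fun z => ∑ j ∈ Finset.range J, (c j : ℂ) * partialSum m g j j z)
          - fun z => ∑ j ∈ Finset.range (M m r), (c j : ℂ) * partialSum m g j j z)
          - fun z => ∑ j ∈ Finset.Ico (M m r) J, (c j : ℂ) * g z := by
    ext z
    rw [Pi.sub_apply, Pi.sub_apply, ← Finset.sum_Ico_eq_sub _ hJ, ← Finset.sum_sub_distrib]
    refine Finset.sum_congr rfl fun j hj => ?_
    rw [← partialSum_sub_partialSum_sub_self hm hf (Finset.mem_Ico.1 hj).1, mul_sub]
  have weights : ∑ j ∈ Finset.Ico (M m r) J, |c j| ≤ ∑ j ∈ Finset.range J, |c j| :=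
    Finset.sum_le_sum_of_subset_of_nonneg
      (fun j hj => Finset.mem_range.2 (Finset.mem_Ico.1 hj).2) fun _ _ _ => abs_nonneg _
  have norm_g := eLpNorm_sub_partialSum_M_le hm hfm hf hp r
  rw [decomposition, ENNReal.ofReal_add (by positivity) (by positivity),
    ENNReal.ofReal_add (by positivity) (by positivity)]
  calc _ ≤ _ := eLpNorm_sub_le (Measurable.aestronglyMeasurable (by fun_prop))
        (Measurable.aestronglyMeasurable (by fun_prop)) hp
    _ ≤ _ := add_le_add_left (eLpNorm_sub_le (Measurable.aestronglyMeasurable (by fun_prop))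
        (Measurable.aestronglyMeasurable (by fun_prop)) hp) _
    _ ≤ _ := add_le_add (add_le_add (sum_bound J) (sum_bound (M m r)))
        (eLpNorm_sum_mul_le _ c g p)
    _ ≤ _ := by
        rw [← add_mul, ← add_mul]
        gcongr

variable {B : ℕ} (hB : ∀ k, m k ≤ B)
include hB

lemma eLpNorm_sum_Ico_M_mul_partialSum_sub_self_le (hfm : Measurable f)
    (hf : Integrable f (haar2 m)) {p : ℝ≥0∞} (hp : 1 ≤ p) {c : ℕ → ℝ} {W : ℝ} {r : ℕ}
    (hc : ∀ j < M m (r + 1), |c j| ≤ W) :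
    eLpNorm (fun z => ∑ j ∈ Finset.Ico (M m r) (M m (r + 1)),
        (c j : ℂ) * (partialSum m f j j z - f z)) p (haar2 m)
      ≤ ENNReal.ofReal ((2 * quadConst B + 1) * (W * M m (r + 1)))
        * (omega1 m f r p + omega2 m f r p) := by
  have hW : 0 ≤ W := (abs_nonneg _).trans (hc 0 (M_pos _))
  have hM : M m r ≤ M m (r + 1) := M_le_M (Nat.le_succ r)
  have hq := quadConst_nonneg B
  have weights : ∑ j ∈ Finset.range (M m (r + 1)), |c j| ≤ W * M m (r + 1) :=
    (Finset.sum_le_card_nsmul _ _ W fun j hj => hc j (Finset.mem_range.1 hj)).trans_eq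
      (by rw [Finset.card_range, nsmul_eq_mul, mul_comm])
  refine (eLpNorm_sum_Ico_mul_partialSum_sub_self_le hm hfm hf hp c hM).trans ?_
  gcongr
  calc _ ≤ quadConst B * (W * M m (r + 1)) + quadConst B * (W * M m r) + W * M m (r + 1) := by
        gcongr
        · exact integral_norm_quadKernel_le hm hB hc
        · exact integral_norm_quadKernel_le hm hB fun j hj => hc j (hj.trans_le hM)
    _ ≤ quadConst B * (W * M m (r + 1)) + quadConst B * (W * M m (r + 1)) + W * M m (r + 1) := by
        gcongr
    _ = _ := by ring

lemma eLpNorm_sum_Ico_cesaroA_mul_partialSum_sub_self_le {α : ℝ} (h0 : 0 < α) (h1 : α < 1)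
    (hfm : Measurable f) (hf : Integrable f (haar2 m)) {p : ℝ≥0∞} (hp : 1 ≤ p) {k n : ℕ}
    (hn : M m (k + 1) ≤ n) (hn' : n ≤ M m (k + 2)) :
    eLpNorm (fun z => ∑ j ∈ Finset.Ico (M m k) (n + 1),
        (cesaroA (-α - 1) (n - j) : ℂ) * (partialSum m f j j z - f z)) p (haar2 m)
      ≤ ENNReal.ofReal ((3 * cesaroConst B α + 4 * quadConst B + 2) * (k + 1 : ℕ))
        * (omega1 m f k p + omega2 m f k p) := by
  have h2M : 2 * M m k ≤ M m (k + 1) := by simpa using two_pow_mul_M_le hm k 1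
  have hMn : M m k ≤ n + 1 := by omega
  have hM : (1 : ℝ) ≤ M m (k + 1) := by exact_mod_cast M_pos (m := m) (k + 1)
  have full_kernel : ∫ z, ‖quadKernel m (fun j => cesaroA (-α - 1) (n - j)) (n + 1) z.1 z.2‖
      ∂haar2 m ≤ cesaroConst B α * ((k + 2 : ℕ) + 1) := by
    simpa only [cesaroKernel_eq_quadKernel] using integral_norm_cesaroKernel_le h0 h1 hm hB hn'
  have initial_kernel : ∫ z, ‖quadKernel m (fun j => cesaroA (-α - 1) (n - j)) (M m k) z.1 z.2‖
      ∂haar2 m ≤ quadConst B * 4 := by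
    refine (integral_norm_quadKernel_le hm hB fun j hj =>
      abs_cesaroA_neg_sub_one_sub_le h0 h1 (M_pos _) hn (by omega)).trans ?_
    have hq := quadConst_nonneg B
    gcongr
    calc 4 * (M m (k + 1) : ℝ) ^ (-α - 1) * M m k
        ≤ 4 * (M m (k + 1) : ℝ) ^ (-1 : ℝ) * M m (k + 1) := by
          gcongr
          · linarith
          · omega
      _ = 4 := by
          rw [Real.rpow_neg_one]
          field_simp
  refine (eLpNorm_sum_Ico_mul_partialSum_sub_self_le hm hfm hf hp _ hMn).trans ?_
  gcongr
  have := sum_range_abs_cesaroA_sub_le h0.le h1 n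
  have := mul_nonneg (cesaroConst_nonneg B h0 h1) (k.cast_nonneg (α := ℝ))
  have := mul_nonneg (quadConst_nonneg B) (k.cast_nonneg (α := ℝ))
  push_cast at full_kernel ⊢
  linarith [k.cast_nonneg (α := ℝ)]

lemma eLpNorm_sigma_sub_self_le_add_sum {α : ℝ} (h0 : 0 < α) (h1 : α < 1)
    (hfm : Measurable f) (hf : Integrable f (haar2 m)) {p : ℝ≥0∞} (hp : 1 ≤ p) {k n : ℕ}
    (hn : M m (k + 1) ≤ n) (hn' : n ≤ M m (k + 2)) :
    eLpNorm (fun z => sigma m α n f z - f z) p (haar2 m)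
      ≤ ENNReal.ofReal (cesaroA (-α) (n - 1))⁻¹ *
        (ENNReal.ofReal ((3 * cesaroConst B α + 4 * quadConst B + 2) * (k + 1 : ℕ))
            * (omega1 m f k p + omega2 m f k p)
          + ∑ r ∈ Finset.range k, ENNReal.ofReal
              ((2 * quadConst B + 1) * (4 * (M m (k + 1) : ℝ) ^ (-α - 1) * M m (r + 1)))
            * (omega1 m f r p + omega2 m f r p)) := by
  have hkn : M m k ≤ n + 1 := ((M_le_M (Nat.le_succ k)).trans hn).trans (Nat.le_succ n)
  let g (j : ℕ) (z : G m × G m) : ℂ :=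
    (cesaroA (-α - 1) (n - j) : ℂ) * (partialSum m f j j z - f z)
  have meas_sum (S : Finset ℕ) : AEStronglyMeasurable (fun z => ∑ j ∈ S, g j z) (haar2 m) :=
    Measurable.aestronglyMeasurable (by fun_prop)
  have decomposition : (fun z => sigma m α n f z - f z) = ((cesaroA (-α) (n - 1))⁻¹ : ℝ) •
      ((fun z => ∑ j ∈ Finset.Ico (M m k) (n + 1), g j z)
        + ∑ r ∈ Finset.range k, fun z => ∑ j ∈ Finset.Ico (M m r) (M m (r + 1)), g j z) := by
    ext z
    simp only [Pi.smul_apply, Pi.add_apply, Finset.sum_apply, Complex.real_smul]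
    rw [sigma_sub_self h1 ((M_pos _).trans_le hn), ← sum_Ico_one_M (fun j => g j z),
      add_comm (∑ j ∈ Finset.Ico (M m k) (n + 1), g j z),
      Finset.sum_Ico_consecutive _ (M_pos k) hkn]
  have last_block :=
    eLpNorm_sum_Ico_cesaroA_mul_partialSum_sub_self_le hm hB h0 h1 hfm hf hp hn hn'
  have early_block (r : ℕ) (hr : r ∈ Finset.range k) :=
    eLpNorm_sum_Ico_M_mul_partialSum_sub_self_le hm hB hfm hf hp (r := r) fun j hj =>
      abs_cesaroA_neg_sub_one_sub_le h0 h1 (M_pos (k + 1)) hn <|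
        calc 2 * j ≤ 2 ^ 1 * M m k := Nat.mul_le_mul_left 2
              (hj.le.trans (M_le_M (Finset.mem_range.1 hr)))
          _ ≤ M m (k + 1) := two_pow_mul_M_le hm k 1
  rw [decomposition, eLpNorm_const_smul, Real.enorm_of_nonneg
    (inv_nonneg.2 (cesaroA_neg_pos h1 _).le)]
  gcongr
  calc _ ≤ _ := eLpNorm_add_le (meas_sum _)
        (Finset.aestronglyMeasurable_sum _ fun r _ => meas_sum _) hp
    _ ≤ _ := add_le_add last_block
        ((eLpNorm_sum_le (fun r _ => meas_sum _) hp).trans (Finset.sum_le_sum early_block))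

/-- The constant `c(α)` of the approximation theorem, for a Vilenkin group with `m_k ≤ B`. -/
noncomputable def approxConst (B : ℕ) (α : ℝ) : ℝ :=
  B / (1 - α) * (2 * (3 * cesaroConst B α + 4 * quadConst B + 2) + 4 * B * (2 * quadConst B + 1))

lemma eLpNorm_sigma_sub_self_le {α : ℝ} (h0 : 0 < α) (h1 : α < 1)
    (hfm : Measurable f) (hf : Integrable f (haar2 m)) {p : ℝ≥0∞} (hp : 1 ≤ p) {k n : ℕ}
    (hn : M m (k + 1) ≤ n) (hn' : n ≤ M m (k + 2)) :
    eLpNorm (fun z => sigma m α n f z - f z) p (haar2 m)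
      ≤ ENNReal.ofReal (approxConst B α) *
        (ENNReal.ofReal ((M m (k + 1) : ℝ) ^ α * Real.log n)
            * (omega1 m f k p + omega2 m f k p)
          + ∑ r ∈ Finset.range k, ENNReal.ofReal ((M m r : ℝ) / M m (k + 1))
            * (omega1 m f r p + omega2 m f r p)) := by
  have : 0 < 1 - α := sub_pos.2 h1
  have hM : (0 : ℝ) < M m (k + 1) := by exact_mod_cast M_pos (m := m) (k + 1)
  have hq := quadConst_nonneg B
  have hC := cesaroConst_nonneg B h0 h1
  have hc : 0 ≤ approxConst B α := by
    unfold approxConst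
    positivity
  have hA : 0 ≤ (cesaroA (-α) (n - 1))⁻¹ := inv_nonneg.2 (cesaroA_neg_pos h1 _).le
  have inv_le := inv_cesaroA_neg_pred_le h0 h1 ((M_pos (k + 1)).trans_le hn)
    (hn'.trans (Nat.mul_le_mul_right _ (hB (k + 1))))
  have log_ge := natCast_le_two_mul_log
    (by simpa [M] using (two_pow_mul_M_le hm 0 (k + 1)).trans (by simpa using hn))
  refine (eLpNorm_sigma_sub_self_le_add_sum hm hB h0 h1 hfm hf hp hn hn').trans ?_
  rw [mul_add, mul_add (ENNReal.ofReal (approxConst B α)), Finset.mul_sum, Finset.mul_sum]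
  refine add_le_add (ofReal_mul_ofReal_mul_le hA hc ?_ _)
    (Finset.sum_le_sum fun r _ => ofReal_mul_ofReal_mul_le hA hc ?_ _)
  · calc _ ≤ B / (1 - α) * (M m (k + 1) : ℝ) ^ α
          * ((3 * cesaroConst B α + 4 * quadConst B + 2) * (2 * Real.log n)) := by gcongr
      _ = B / (1 - α) * (2 * (3 * cesaroConst B α + 4 * quadConst B + 2))
          * ((M m (k + 1) : ℝ) ^ α * Real.log n) := by ring
      _ ≤ _ := by
        have := Real.log_natCast_nonneg n
        unfold approxConst
        gcongr
        exact le_add_of_nonneg_right (by positivity)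
  · have M_succ_le : (M m (r + 1) : ℝ) ≤ B * M m r := by
      exact_mod_cast Nat.mul_le_mul_right _ (hB r)
    calc _ ≤ B / (1 - α) * (M m (k + 1) : ℝ) ^ α
          * ((2 * quadConst B + 1) * (4 * (M m (k + 1) : ℝ) ^ (-α - 1) * (B * M m r))) := by
          gcongr
      _ = B / (1 - α) * (4 * B * (2 * quadConst B + 1)) * ((M m r : ℝ) / M m (k + 1)) := by
          rw [Real.rpow_sub_one hM.ne', Real.rpow_neg hM.le]
          field_simp
      _ ≤ _ := by
          unfold approxConst
          gcongr
          exact le_add_of_nonneg_left (by positivity)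

end Approximation

lemma neZero_of_two_le {m : ℕ → ℕ} (hm : ∀ k, 2 ≤ m k) (k : ℕ) : NeZero (m k) :=
  ⟨(zero_lt_two.trans_le (hm k)).ne'⟩

section AlmostEverywhere

variable {m : ℕ → ℕ} {f g : G m × G m → ℂ}

lemma sigma_congr_ae (h : f =ᵐ[haar2 m] g) (α : ℝ) (n : ℕ) :
    sigma m α n f = sigma m α n g := by
  have coeff (a b : ℕ) : fourierCoeff m f a b = fourierCoeff m g a b :=
    integral_congr_ae (h.mono fun w hw => by simp only [hw])
  ext z
  simp only [sigma, partialSum, coeff]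

variable [∀ k, NeZero (m k)]

lemma ae_eq_comp_add_right (h : f =ᵐ[haar2 m] g) (w : G m × G m) :
    (fun z => f (z + w)) =ᵐ[haar2 m] fun z => g (z + w) :=
  (measurePreserving_add_right (haar2 m) w).quasiMeasurePreserving.ae_eq_comp h

lemma omega1_congr_ae (h : f =ᵐ[haar2 m] g) (n : ℕ) (p : ℝ≥0∞) :
    omega1 m f n p = omega1 m g n p := by
  refine iSup_congr fun u => iSup_congr fun _ => eLpNorm_congr_ae ?_
  simpa [Prod.add_def, Pi.sub_def] using (ae_eq_comp_add_right h (u, 0)).sub h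

lemma omega2_congr_ae (h : f =ᵐ[haar2 m] g) (n : ℕ) (p : ℝ≥0∞) :
    omega2 m f n p = omega2 m g n p := by
  refine iSup_congr fun v => iSup_congr fun _ => eLpNorm_congr_ae ?_
  simpa [Prod.add_def, Pi.sub_def] using (ae_eq_comp_add_right h (0, v)).sub h

end AlmostEverywhere

end Vilenkin

theorem theorem2_general (B : ℕ) (α : ℝ) (hα : α ∈ Set.Ioo (0 : ℝ) 1) :
    ∃ c : ℝ≥0, ∀ m : ℕ → ℕ, (∀ k, 2 ≤ m k) → (∀ k, m k ≤ B) →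
      ∀ (p : ℝ≥0∞) (f : Vilenkin.G m × Vilenkin.G m → ℂ), 1 ≤ p →
        Integrable f (Vilenkin.haar2 m) →
        ∀ k n : ℕ, 1 ≤ k → Vilenkin.M m k ≤ n → n < Vilenkin.M m (k + 1) →
          eLpNorm (fun z => Vilenkin.sigma m α n f z - f z) p (Vilenkin.haar2 m) ≤
            (c : ℝ≥0∞) *
              (ENNReal.ofReal ((Vilenkin.M m k : ℝ) ^ α * Real.log n) *
                  (Vilenkin.omega1 m f (k - 1) p + Vilenkin.omega2 m f (k - 1) p) +
                ∑ r ∈ Finset.range (k - 1),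
                  ENNReal.ofReal ((Vilenkin.M m r : ℝ) / (Vilenkin.M m k : ℝ)) *
                    (Vilenkin.omega1 m f r p + Vilenkin.omega2 m f r p)) := by
  refine ⟨(Vilenkin.approxConst B α).toNNReal, fun m hm hB p f hp hf k n hk hn hn' => ?_⟩
  have := Vilenkin.neZero_of_two_le hm
  obtain ⟨k, rfl⟩ := Nat.exists_eq_add_of_le' hk
  obtain ⟨g, hgm, hfg⟩ := hf.1
  have error_congr : (fun z => Vilenkin.sigma m α n f z - f z)
      =ᵐ[Vilenkin.haar2 m] fun z => Vilenkin.sigma m α n g z - g z := by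
    rw [Vilenkin.sigma_congr_ae hfg]
    exact hfg.mono fun z hz => by simp only [hz]
  rw [eLpNorm_congr_ae error_congr]
  simp only [Vilenkin.omega1_congr_ae hfg, Vilenkin.omega2_congr_ae hfg]
  exact Vilenkin.eLpNorm_sigma_sub_self_le hm hB hα.1 hα.2 hgm.measurable (hf.congr hfg) hp hn
    hn'.le

theorem theorem2 (B : ℕ) (α : ℝ) (hα : α ∈ Set.Ioo (0 : ℝ) 1) :
    ∃ c : ℝ≥0, ∀ m : ℕ → ℕ, (∀ k, 2 ≤ m k) → (∀ k, m k ≤ B) →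
      ∀ (p : ℝ≥0∞) (f : Vilenkin.G m × Vilenkin.G m → ℂ), 1 ≤ p → Vilenkin.InLp m p f →
        ∀ k n : ℕ, 1 ≤ k → Vilenkin.M m k ≤ n → n < Vilenkin.M m (k + 1) →
          eLpNorm (fun z => Vilenkin.sigma m α n f z - f z) p (Vilenkin.haar2 m) ≤
            (c : ℝ≥0∞) *
              (ENNReal.ofReal ((Vilenkin.M m k : ℝ) ^ α * Real.log n) *
                  (Vilenkin.omega1 m f (k - 1) p + Vilenkin.omega2 m f (k - 1) p) +
                ∑ r ∈ Finset.range (k - 1),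
                  ENNReal.ofReal ((Vilenkin.M m r : ℝ) / (Vilenkin.M m k : ℝ)) *
                    (Vilenkin.omega1 m f r p + Vilenkin.omega2 m f r p)) := by
  refine (theorem2_general B α hα).imp fun c hc m hm hB p f hp hf => ?_
  have := Vilenkin.neZero_of_two_le hm
  exact hc m hm hB p f hp (hf.1.integrable hp)
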